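/- Let $\mathbb{K}$ be a field of characteristic $0$. Let $\Lambda$ be the Hopf algebra of symmetric functions over $\mathbb{K}$, i.e. of the formal power series of bounded degree in countably many variables $x_1,x_2,\dots$ that are invariant under all permutations of the variables, with the usual product, with the coproduct that is the algebra homomorphism satisfying $\Delta p_n=p_n\otimes 1+1\otimes p_n$ for the power sums $p_n=\sum_i x_i^n$, $n\ge 1$, and with the counit $f\mapsto f(0,0,\dots)$. For a partition $\lambda$ let $\widetilde m_\lambda=\big(\prod_{i\ge1} r_i(\lambda)!\big)\,m_\lambda$ be the augmented monomial symmetric function, where $r_i(\lambda)$ is the number of parts of $\lambda$ equal to $i$ and $m_\lambda$ is the sum of all distinct monomials whose nonzero exponents are the parts of $\lambda$. Let $\widetilde\Lambda$ be the Hopf algebra with the same underlying vector space, coproduct and counit as $\Lambda$, but with the bilinear product determined by $\widetilde m_\lambda\odot\widetilde m_\mu=\widetilde m_{\lambda\sqcup\mu}$, where $\lambda\sqcup\mu$ is the partition whose parts are all parts of $\lambda$ together with all parts of $\mu$. For a finite simple graph $G$ let $X_G=\sum_\kappa\prod_{v\in V(G)}x_{\kappa(v)}$, the sum being over all proper colorings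 $\kappa:V(G)\to\{1,2,\dots\}$, be its chromatic symmetric function, and let $\overline G$ be the complement of $G$. Let $\phi:\Lambda\to\widetilde\Lambda$ be a morphism of Hopf algebras (a linear map that preserves product, unit, coproduct and counit; it is not assumed to be graded) with $\phi(p_3)=c\,\widetilde m_3$ for some $c\in\mathbb{K}$, and let $F$ be a family of (unweighted) finite connected simple graphs that contains, for every positive integer $n$, at least one graph with exactly $n$ vertices. If $\phi(X_G)=X_{\overline G}$ for every $G\in F$, then one of the following holds: (1) $c=0$ and every graph in $F$ is triangle-free; (2) $c=\tfrac12$ and $F$ is the family of cliques, i.e. every graph in $F$ is a complete graph, and for each $n\ge1$ the complete graph on $n$ vertices is, up to isomorphism, in $F$. -/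

import Mathlib

open scoped TensorProduct

namespace ChromSym

noncomputable section

/-- The underlying algebra of symmetric functions over `K`: formal power series in the variables
`x_0, x_1, x_2, …` that have bounded degree and are fixed by every permutation of the variables. -/
def Lam (K : Type*) [Field K] : Subalgebra K (MvPowerSeries ℕ K) where
  carrier := {f | (∀ σ : Equiv.Perm ℕ, MvPowerSeries.rename (R := K) σ f = f) ∧
    ∃ N : ℕ, ∀ d : ℕ →₀ ℕ, MvPowerSeries.coeff d f ≠ 0 → d.degree ≤ N}
  mul_mem' := by
    rintro f g ⟨hf, N, hN⟩ ⟨hg, M, hM⟩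
    refine ⟨fun σ => by rw [map_mul, hf, hg], N + M, fun d hd => ?_⟩
    rw [MvPowerSeries.coeff_mul] at hd
    obtain ⟨⟨a, b⟩, hab, h⟩ := Finset.exists_ne_zero_of_sum_ne_zero hd
    have hab' : a + b = d := Finset.HasAntidiagonal.mem_antidiagonal.1 hab
    rw [← hab', map_add]
    exact Nat.add_le_add (hN a (left_ne_zero_of_mul h)) (hM b (right_ne_zero_of_mul h))
  add_mem' := by
    rintro f g ⟨hf, N, hN⟩ ⟨hg, M, hM⟩
    refine ⟨fun σ => by rw [map_add, hf, hg], N + M, fun d hd => ?_⟩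
    rw [map_add] at hd
    by_cases h : MvPowerSeries.coeff d f = 0
    · rw [h, zero_add] at hd
      exact (hM d hd).trans (Nat.le_add_left _ _)
    · exact (hN d h).trans (Nat.le_add_right _ _)
  algebraMap_mem' := by
    intro c
    refine ⟨fun σ => AlgHom.commutes _ c, 0, fun d hd => ?_⟩
    classical
    rw [MvPowerSeries.algebraMap_apply, MvPowerSeries.coeff_C] at hd
    by_cases h : d = 0
    · simp [h]
    · simp [h] at hd

/-- Invariance under permutations, coefficientwise. -/
theorem rename_eq_self_iff {K : Type*} [Field K] (f : MvPowerSeries ℕ K) :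
    (∀ σ : Equiv.Perm ℕ, MvPowerSeries.rename (R := K) σ f = f) ↔
      ∀ (σ : Equiv.Perm ℕ) (d : ℕ →₀ ℕ),
        MvPowerSeries.coeff (d.equivMapDomain σ) f = MvPowerSeries.coeff d f := by
  have key : ∀ (σ : Equiv.Perm ℕ) (d : ℕ →₀ ℕ),
      MvPowerSeries.coeff (d.equivMapDomain σ) (MvPowerSeries.rename (R := K) σ f) =
        MvPowerSeries.coeff d f := by
    intro σ d
    have := MvPowerSeries.coeff_embDomain_rename (R := K) σ.toEmbedding f d
    rw [Finsupp.embDomain_eq_mapDomain] at this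
    rw [Finsupp.equivMapDomain_eq_mapDomain]
    exact this
  constructor
  · intro h σ d
    rw [← key σ d, h σ]
  · intro h σ
    ext d
    have := key σ (d.equivMapDomain σ.symm)
    rw [h, ← Finsupp.equivMapDomain_trans] at this
    simpa using this

theorem equivMapDomain_sum_single {V : Type*} [Fintype V] (σ : Equiv.Perm ℕ) (κ : V → ℕ)
    (w : V → ℕ) :
    (∑ v, Finsupp.single (κ v) (w v)).equivMapDomain σ =
      ∑ v, Finsupp.single (σ (κ v)) (w v) := by
  rw [Finsupp.equivMapDomain_eq_mapDomain, Finsupp.mapDomain_finsetSum]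
  simp

/-- The chromatic symmetric function of a graph `G` with vertex weights `w`, as a power series:
the coefficient of the monomial with exponent `d` is the number of proper colourings `κ` with
`∏ v, x_{κ v} ^ w v` equal to that monomial. The number is finite. -/
def csfSeries (K : Type*) [Field K] {V : Type*} [Fintype V] (G : SimpleGraph V) (w : V → ℕ+) :
    MvPowerSeries ℕ K := fun d =>
  (Nat.card {κ : G.Coloring ℕ // ∑ v, Finsupp.single (κ v) (w v : ℕ) = d} : K)

theorem csfSeries_mem (K : Type*) [Field K] {V : Type*} [Fintype V] (G : SimpleGraph V)
    (w : V → ℕ+) : csfSeries K G w ∈ Lam K := by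
  refine ⟨(rename_eq_self_iff _).2 fun σ d => ?_, ∑ v, (w v : ℕ), fun d hd => ?_⟩
  · have e : {κ : G.Coloring ℕ // ∑ v, Finsupp.single (κ v) (w v : ℕ) = d} ≃
        {κ : G.Coloring ℕ // ∑ v, Finsupp.single (κ v) (w v : ℕ) = d.equivMapDomain σ} :=
      { toFun := fun κ => ⟨SimpleGraph.Coloring.mk (fun v => σ (κ.1 v))
            fun h h' => κ.1.valid h (σ.injective h'), by
          exact (equivMapDomain_sum_single σ _ _).symm.trans (congrArg _ κ.2)⟩
        invFun := fun κ => ⟨SimpleGraph.Coloring.mk (fun v => σ.symm (κ.1 v))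
            fun h h' => κ.1.valid h (σ.symm.injective h'), by
          have := equivMapDomain_sum_single σ.symm (fun v => κ.1 v) (fun v => (w v : ℕ))
          rw [κ.2, ← Finsupp.equivMapDomain_trans] at this
          refine Eq.trans this.symm ?_
          simp⟩
        left_inv := fun κ => by ext v; exact σ.symm_apply_apply _
        right_inv := fun κ => by ext v; exact σ.apply_symm_apply _ }
    exact congrArg Nat.cast (Nat.card_congr e).symm
  · have h : Nat.card {κ : G.Coloring ℕ // ∑ v, Finsupp.single (κ v) (w v : ℕ) = d} ≠ 0 := by
      intro h
      exact hd (by rw [MvPowerSeries.coeff_apply, csfSeries, h, Nat.cast_zero])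
    obtain ⟨⟨κ, hκ⟩⟩ := (Nat.card_ne_zero.1 h).1
    rw [← hκ, map_sum]
    simp

theorem finite_colorings {V : Type*} [Fintype V] (G : SimpleGraph V) (w : V → ℕ+) (d : ℕ →₀ ℕ) :
    Finite {κ : G.Coloring ℕ // ∑ v, Finsupp.single (κ v) (w v : ℕ) = d} := by
  have : ∀ κ : {κ : G.Coloring ℕ // ∑ v, Finsupp.single (κ v) (w v : ℕ) = d}, ∀ v,
      κ.1 v ∈ d.support := by
    rintro ⟨κ, rfl⟩ v
    rw [Finsupp.mem_support_iff, Finsupp.finsetSum_apply]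
    refine (Finset.sum_pos' (fun _ _ => Nat.zero_le _) ⟨v, Finset.mem_univ v, ?_⟩).ne'
    simp
  refine Finite.of_injective (fun κ => fun v => (⟨κ.1 v, this κ v⟩ : d.support)) ?_
  intro κ κ' h
  ext v
  exact congrArg Subtype.val (congrFun h v)

/-- The chromatic symmetric function `X_G` of a weighted graph. -/
def csf (K : Type*) [Field K] {V : Type*} [Fintype V] (G : SimpleGraph V) (w : V → ℕ+) : Lam K :=
  ⟨csfSeries K G w, csfSeries_mem K G w⟩

/-- The power series `p_n = ∑ i, x_i ^ n`. -/
def psumSeries (K : Type*) [Field K] (n : ℕ+) : MvPowerSeries ℕ K := fun d =>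
  open Classical in if ∃ i : ℕ, d = Finsupp.single i (n : ℕ) then 1 else 0

theorem psumSeries_mem (K : Type*) [Field K] (n : ℕ+) : psumSeries K n ∈ Lam K := by
  refine ⟨(rename_eq_self_iff _).2 fun σ d => ?_, n, fun d hd => ?_⟩
  · simp only [MvPowerSeries.coeff_apply, psumSeries]
    congr 1
    refine propext ⟨?_, ?_⟩
    · rintro ⟨i, h⟩
      refine ⟨σ.symm i, ?_⟩
      have := congrArg (Finsupp.equivMapDomain σ.symm) h
      rw [← Finsupp.equivMapDomain_trans, Finsupp.equivMapDomain_single] at this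
      simpa using this
    · rintro ⟨i, rfl⟩
      exact ⟨σ i, Finsupp.equivMapDomain_single _ _ _⟩
  · simp only [MvPowerSeries.coeff_apply, psumSeries] at hd
    by_cases h : ∃ i : ℕ, d = Finsupp.single i (n : ℕ)
    · obtain ⟨i, rfl⟩ := h
      simp
    · rw [if_neg h] at hd
      exact absurd rfl hd

/-- The power sum `p_n` as a symmetric function. -/
def psum (K : Type*) [Field K] (n : ℕ+) : Lam K := ⟨psumSeries K n, psumSeries_mem K n⟩

/-- The partition with the single part `k`, as a multiplicity function (empty if `k = 0`). -/
def part (k : ℕ) : ℕ+ →₀ ℕ := if h : 0 < k then Finsupp.single (k.toPNat h) 1 else 0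

/-- The partition formed by the nonzero exponents of the monomial `x ^ d`, as a multiplicity
function: `shape d n` is the number of `j` with `d j = n`, see `shape_apply`. -/
def shape (d : ℕ →₀ ℕ) : ℕ+ →₀ ℕ := d.sum fun _ k => part k

theorem shape_apply (d : ℕ →₀ ℕ) (n : ℕ+) :
    shape d n = (d.support.filter fun j => d j = n).card := by
  rw [shape, Finsupp.sum, Finsupp.finsetSum_apply, Finset.card_filter]
  refine Finset.sum_congr rfl fun j hj => ?_
  have h0 : 0 < d j := Nat.pos_of_ne_zero (Finsupp.mem_support_iff.1 hj)
  rw [part, dif_pos h0, Finsupp.single_apply]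
  refine if_congr ?_ rfl rfl
  rw [← PNat.coe_inj]; rfl

theorem exists_perm {d d' : ℕ →₀ ℕ} (h : shape d = shape d') :
    ∃ σ : Equiv.Perm ℕ, d.equivMapDomain σ = d' := by
  have key : ∀ c : ℕ, Nonempty ({a // d a = c} ≃ {b // d' b = c}) := by
    intro c
    rcases Nat.eq_zero_or_pos c with rfl | hc
    · have inf : ∀ d : ℕ →₀ ℕ, Infinite {a // d a = 0} := by
        intro d
        have : {a | d a = 0} = ((d.support : Set ℕ))ᶜ := by ext; simp
        have h := d.support.finite_toSet.infinite_compl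
        rw [← this] at h
        exact h.to_subtype
      have := inf d
      have := inf d'
      exact nonempty_equiv_of_countable
    · have card : ∀ d : ℕ →₀ ℕ, Nonempty ({a // d a = c} ≃ Fin (shape d (c.toPNat hc))) := by
        intro d
        rw [shape_apply]
        refine ⟨(Equiv.subtypeEquivRight
          (q := fun a => a ∈ d.support.filter fun j => d j = (c.toPNat hc : ℕ)) fun a => ⟨fun h : d a = c => Finset.mem_filter.2
          ⟨Finsupp.mem_support_iff.2 (by rw [h]; exact hc.ne'), h⟩, fun h => (Finset.mem_filter.1 h).2⟩).trans
          (Finset.equivFin _)⟩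
      obtain ⟨e⟩ := card d
      obtain ⟨e'⟩ := card d'
      exact ⟨e.trans ((finCongr (by rw [h])).trans e'.symm)⟩
  have he := Equiv.ofFiberEquiv_map (f := d) (g := d') (fun c => (key c).some)
  refine ⟨Equiv.ofFiberEquiv fun c => (key c).some, ?_⟩
  ext b
  rw [Finsupp.equivMapDomain_apply, ← he, Equiv.apply_symm_apply]

theorem shape_equivMapDomain (σ : Equiv.Perm ℕ) (d : ℕ →₀ ℕ) :
    shape (d.equivMapDomain σ) = shape d := by
  rw [shape, shape, Finsupp.sum_equivMapDomain]

theorem shape_zero : shape 0 = 0 := Finsupp.sum_zero_index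

theorem part_zero : part 0 = 0 := by simp [part]

theorem shape_update (d : ℕ →₀ ℕ) (j k : ℕ) :
    shape (d.update j k) + part (d j) = shape d + part k := by
  have h : ∀ d : ℕ →₀ ℕ, shape d = shape (d.erase j) + part (d j) := by
    intro d
    rw [shape, shape]
    by_cases hj : j ∈ d.support
    · rw [add_comm]; exact (Finsupp.add_sum_erase d j (fun _ k => part k) hj).symm
    · rw [Finsupp.notMem_support_iff.1 hj, part_zero, add_zero, Finsupp.erase_of_notMem_support hj]
  rw [h (d.update j k), h d, Finsupp.erase_update_eq_erase]
  simp only [Finsupp.coe_update, Function.update_self]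
  abel

theorem exists_shape (r : ℕ+ →₀ ℕ) : ∃ d : ℕ →₀ ℕ, shape d = r := by
  have key : ∀ m : Multiset ℕ+, ∃ d : ℕ →₀ ℕ, shape d = Multiset.toFinsupp m := by
    intro m
    induction m using Multiset.induction_on with
    | empty => exact ⟨0, by rw [shape_zero, map_zero]⟩
    | cons n m ih =>
      obtain ⟨d, hd⟩ := ih
      obtain ⟨j, hj⟩ := Infinite.exists_notMem_finset d.support
      refine ⟨d.update j n, ?_⟩
      have := shape_update d j n
      rw [Finsupp.notMem_support_iff.1 hj, part_zero, add_zero] at this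
      rw [this, hd, ← Multiset.singleton_add, map_add, Multiset.toFinsupp_singleton, add_comm,
        part, dif_pos n.pos]
      rfl
  obtain ⟨d, hd⟩ := key (Finsupp.toMultiset r)
  exact ⟨d, hd.trans (Finsupp.toMultiset_toFinsupp r)⟩

theorem part_coe (n : ℕ+) : part n = Finsupp.single n 1 := by
  rw [part, dif_pos n.pos]; rfl

theorem weight_shape (d : ℕ →₀ ℕ) :
    Finsupp.weight (fun i : ℕ+ => (i : ℕ)) (shape d) = d.degree := by
  rw [shape, map_finsuppSum, Finsupp.degree_apply, Finsupp.sum]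
  refine Finset.sum_congr rfl fun j _ => ?_
  rcases Nat.eq_zero_or_pos (d j) with h | h
  · rw [h, part_zero, map_zero]
  · obtain ⟨n, hn⟩ : ∃ n : ℕ+, (n : ℕ) = d j := ⟨⟨_, h⟩, rfl⟩
    rw [← hn, part_coe, Finsupp.weight_single]
    simp

theorem mem_of_shape {K : Type*} [Field K] (f : MvPowerSeries ℕ K) (N : ℕ)
    (h : ∀ d d', shape d = shape d' → MvPowerSeries.coeff d f = MvPowerSeries.coeff d' f)
    (hN : ∀ d, MvPowerSeries.coeff d f ≠ 0 →
      Finsupp.weight (fun i : ℕ+ => (i : ℕ)) (shape d) ≤ N) : f ∈ Lam K :=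
  ⟨(rename_eq_self_iff f).2 fun σ d => h _ _ (shape_equivMapDomain σ d), N, fun d hd => by
    rw [← weight_shape]; exact hN d hd⟩

/-- The monomial symmetric function `m_λ` as a power series: the sum of all distinct monomials
whose nonzero exponents are the parts of `λ`. The partition `λ` is encoded by the multiplicities
`r i` of the parts `i`, so that `λ ⊔ μ` corresponds to the sum of the multiplicity functions. -/
def monoSeries (K : Type*) [Field K] (r : ℕ+ →₀ ℕ) : MvPowerSeries ℕ K :=
  fun d => if shape d = r then 1 else 0

theorem coeff_monoSeries {K : Type*} [Field K] (r : ℕ+ →₀ ℕ) (d : ℕ →₀ ℕ) :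
    MvPowerSeries.coeff d (monoSeries K r) = if shape d = r then 1 else 0 := rfl

/-- The monomial symmetric function `m_λ`. -/
def mono (K : Type*) [Field K] (r : ℕ+ →₀ ℕ) : Lam K :=
  ⟨monoSeries K r, mem_of_shape _ (Finsupp.weight (fun i : ℕ+ => (i : ℕ)) r)
    (fun d d' h => by rw [coeff_monoSeries, coeff_monoSeries, h])
    (fun d hd => by
      rw [coeff_monoSeries] at hd
      by_cases h : shape d = r
      · rw [h]
      · rw [if_neg h] at hd; exact absurd rfl hd)⟩

/-- `∏ i, r_i !` -/
def fac (r : ℕ+ →₀ ℕ) : ℕ := r.prod fun _ k => k.factorial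

/-- The augmented monomial symmetric function `m̃_λ = (∏ i, r_i(λ)!) m_λ`. -/
def mTilde (K : Type*) [Field K] (r : ℕ+ →₀ ℕ) : Lam K := (fac r : K) • mono K r

theorem fac_ne_zero (r : ℕ+ →₀ ℕ) : fac r ≠ 0 :=
  Finset.prod_ne_zero_iff.2 fun _ _ => Nat.factorial_ne_zero _

theorem fac_add_single (r : ℕ+ →₀ ℕ) (n : ℕ+) :
    fac (r + Finsupp.single n 1) = fac r * (r n + 1) := by
  classical
  have h : ∀ s : ℕ+ →₀ ℕ, fac s = (s n).factorial * fac (s.erase n) := by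
    intro s
    by_cases hn : n ∈ s.support
    · exact (Finsupp.mul_prod_erase s n (fun _ k => k.factorial) hn).symm
    · rw [Finsupp.notMem_support_iff.1 hn, Finsupp.erase_of_notMem_support hn]
      simp
  rw [h (r + Finsupp.single n 1), h r, Finsupp.erase_add, Finsupp.erase_single, add_zero,
    Finsupp.add_apply, Finsupp.single_eq_same, Nat.factorial_succ]
  ring

theorem coeff_mono {K : Type*} [Field K] (r : ℕ+ →₀ ℕ) (d : ℕ →₀ ℕ) :
    MvPowerSeries.coeff d (mono K r : MvPowerSeries ℕ K) = if shape d = r then 1 else 0 := rfl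

theorem coeff_mTilde {K : Type*} [Field K] (r : ℕ+ →₀ ℕ) (d : ℕ →₀ ℕ) :
    MvPowerSeries.coeff d (mTilde K r : MvPowerSeries ℕ K) =
      if shape d = r then (fac r : K) else 0 := by
  have : (mTilde K r : MvPowerSeries ℕ K) = (fac r : K) • (mono K r : MvPowerSeries ℕ K) := rfl
  rw [this, MvPowerSeries.coeff_smul, coeff_mono, mul_ite, mul_one, mul_zero]

/-- The linear map sending the monomial `∏ X_i ^ r_i` to `m̃_λ`, with `r_i = r_i(λ)`. -/
def mTildeMap (K : Type*) [Field K] : MvPolynomial ℕ+ K →ₗ[K] Lam K :=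
  (MvPolynomial.basisMonomials ℕ+ K).constr K (mTilde K)

theorem mTildeMap_monomial {K : Type*} [Field K] (r : ℕ+ →₀ ℕ) :
    mTildeMap K (MvPolynomial.monomial r 1) = mTilde K r := by
  have := (MvPolynomial.basisMonomials ℕ+ K).constr_basis K (mTilde K) r
  rwa [MvPolynomial.coe_basisMonomials] at this

theorem coeff_mTildeMap {K : Type*} [Field K] (P : MvPolynomial ℕ+ K) (d : ℕ →₀ ℕ) :
    MvPowerSeries.coeff d (mTildeMap K P : MvPowerSeries ℕ K) =
      (fac (shape d) : K) * P.coeff (shape d) := by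
  classical
  induction P using MvPolynomial.induction_on' with
  | monomial r a =>
    have h : MvPolynomial.monomial r a = a • MvPolynomial.monomial r (1 : K) := by
      rw [MvPolynomial.smul_monomial, smul_eq_mul, mul_one]
    have h' : (mTildeMap K (MvPolynomial.monomial r a) : MvPowerSeries ℕ K) =
        a • (mTilde K r : MvPowerSeries ℕ K) := by
      rw [h, map_smul, mTildeMap_monomial]; rfl
    rw [h', MvPowerSeries.coeff_smul, coeff_mTilde, MvPolynomial.coeff_monomial]
    by_cases hr : shape d = r
    · rw [if_pos hr, if_pos hr.symm, hr, mul_comm]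
    · rw [if_neg hr, if_neg (Ne.symm hr), mul_zero, mul_zero]
  | add P Q hP hQ =>
    rw [map_add, MvPolynomial.coeff_add, mul_add, ← hP, ← hQ]
    exact map_add _ _ _

theorem finite_weight_le (N : ℕ) :
    {r : ℕ+ →₀ ℕ | Finsupp.weight (fun i : ℕ+ => (i : ℕ)) r ≤ N}.Finite := by
  refine Set.Finite.subset (Finset.finite_toSet
    (Finset.finsupp (Finset.Icc 1 N.succPNat) (fun _ => Finset.range (N + 1)))) fun r hr => ?_
  have hr' : Finsupp.weight (fun i : ℕ+ => (i : ℕ)) r ≤ N := hr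
  have h : ∀ i ∈ r.support, r i * (i : ℕ) ≤ N := by
    intro i hi
    refine le_trans ?_ hr'
    rw [Finsupp.weight_apply]
    exact Finset.single_le_sum (f := fun i : ℕ+ => r i • (i : ℕ)) (fun _ _ => Nat.zero_le _) hi
  rw [Finset.mem_coe, Finset.mem_finsupp_iff]
  refine ⟨fun i hi => ?_, fun i _ => ?_⟩
  · have h1 := h i hi
    have h2 : 1 ≤ r i := Nat.pos_of_ne_zero (Finsupp.mem_support_iff.1 hi)
    rw [Finset.mem_Icc]
    refine ⟨one_le, ?_⟩
    rw [← PNat.coe_le_coe, Nat.succPNat_coe]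
    nlinarith
  · rw [Finset.mem_range]
    by_cases hi : i ∈ r.support
    · have h1 := h i hi
      have h2 := i.pos
      nlinarith
    · rw [Finsupp.notMem_support_iff.1 hi]; omega

theorem mTildeMap_bijective (K : Type*) [Field K] [CharZero K] :
    Function.Bijective (mTildeMap K) := by
  have hfac : ∀ r : ℕ+ →₀ ℕ, (fac r : K) ≠ 0 := fun r => Nat.cast_ne_zero.2 (fac_ne_zero r)
  constructor
  · rw [injective_iff_map_eq_zero]
    intro P hP
    ext r
    obtain ⟨d, rfl⟩ := exists_shape r
    have := coeff_mTildeMap P d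
    rw [hP, ZeroMemClass.coe_zero, map_zero] at this
    simpa [hfac] using this.symm
  · rintro ⟨f, hf, N, hN⟩
    choose rep hrep using exists_shape
    classical
    refine ⟨∑ r ∈ (finite_weight_le N).toFinset,
      MvPolynomial.monomial r (MvPowerSeries.coeff (rep r) f / (fac r : K)), ?_⟩
    apply Subtype.ext
    ext d
    rw [coeff_mTildeMap, MvPolynomial.coeff_sum]
    simp only [MvPolynomial.coeff_monomial]
    rw [Finset.sum_ite_eq' (finite_weight_le N).toFinset (shape d)]
    have hd : MvPowerSeries.coeff (rep (shape d)) f = MvPowerSeries.coeff d f := by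
      obtain ⟨σ, hσ⟩ := exists_perm (hrep (shape d)).symm
      rw [← hσ, (rename_eq_self_iff f).1 hf]
    split_ifs with h
    · rw [hd, mul_div_cancel₀ _ (hfac _)]
    · rw [mul_zero]
      by_contra h0
      exact h (by simpa [weight_shape] using hN d (Ne.symm h0))

/-- The functions `m̃_λ` form a basis of the space of symmetric functions. -/
def mTildeEquiv (K : Type*) [Field K] [CharZero K] : MvPolynomial ℕ+ K ≃ₗ[K] Lam K :=
  LinearEquiv.ofBijective (mTildeMap K) (mTildeMap_bijective K)


theorem coeff_psum_mul {K : Type*} [Field K] (n : ℕ+) (f : MvPowerSeries ℕ K) (d : ℕ →₀ ℕ) :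
    MvPowerSeries.coeff d (psumSeries K n * f) =
      ∑ j ∈ d.support, if (n : ℕ) ≤ d j then
        MvPowerSeries.coeff (d.update j (d j - n)) f else 0 := by
  classical
  have hc : ∀ a : ℕ →₀ ℕ, MvPowerSeries.coeff a (psumSeries K n) =
      if ∃ i : ℕ, a = Finsupp.single i (n : ℕ) then 1 else 0 := by
    intro a
    simp only [MvPowerSeries.coeff_apply, psumSeries]
  rw [MvPowerSeries.coeff_mul, ← Finset.sum_filter]
  simp only [hc, ite_mul, one_mul, zero_mul]
  rw [← Finset.sum_filter]
  symm
  have hupd : ∀ j, (n : ℕ) ≤ d j → Finsupp.single j (n : ℕ) + d.update j (d j - n) = d := by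
    intro j hj
    ext i
    by_cases h : i = j
    · subst h; simp; omega
    · simp [h]
  refine Finset.sum_bij (fun j _ => (Finsupp.single j (n : ℕ), d.update j (d j - n))) ?_ ?_ ?_ ?_
  · intro j hj
    rw [Finset.mem_filter] at hj ⊢
    exact ⟨Finset.HasAntidiagonal.mem_antidiagonal.2 (hupd j hj.2), j, rfl⟩
  · intro j _ j' _ h
    exact Finsupp.single_left_injective n.ne_zero (congrArg Prod.fst h)
  · rintro ⟨a, b⟩ hab
    rw [Finset.mem_filter] at hab
    obtain ⟨h, j, hj⟩ := hab
    have h' : a + b = d := Finset.HasAntidiagonal.mem_antidiagonal.1 h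
    have hj' : a = Finsupp.single j (n : ℕ) := hj
    subst hj'
    have hle : (n : ℕ) ≤ d j := by rw [← h']; simp
    refine ⟨j, ?_, ?_⟩
    · rw [Finset.mem_filter, Finsupp.mem_support_iff]
      exact ⟨by have := n.pos; omega, hle⟩
    · refine Prod.ext rfl ?_
      have h2 := hupd j hle
      conv_rhs at h2 => rw [← h']
      exact add_left_cancel h2
  · intro j _; rfl

theorem sum_support_eq {K : Type*} [Field K] (d : ℕ →₀ ℕ) (F : ℕ → K) :
    ∑ j ∈ d.support, F (d j) = (shape d).sum fun k m => (m : K) * F k := by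
  have hs : shape d = ∑ j ∈ d.support, part (d j) := rfl
  rw [hs, ← Finsupp.sum_finsetSum_index]
  · refine Finset.sum_congr rfl fun j hj => ?_
    obtain ⟨n, hn⟩ : ∃ n : ℕ+, (n : ℕ) = d j :=
      ⟨⟨_, Nat.pos_of_ne_zero (Finsupp.mem_support_iff.1 hj)⟩, rfl⟩
    rw [← hn, part_coe, Finsupp.sum_single_index] <;> simp
  · simp
  · intro a b c; push_cast; ring

/-- The derivation `X_k ↦ X_{k+n}`. -/
def shiftD (K : Type*) [Field K] (n : ℕ+) :
    Derivation K (MvPolynomial ℕ+ K) (MvPolynomial ℕ+ K) :=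
  MvPolynomial.mkDerivation K fun k => MvPolynomial.X (k + n)

theorem shiftD_monomial {K : Type*} [Field K] (n : ℕ+) (s : ℕ+ →₀ ℕ) :
    shiftD K n (MvPolynomial.monomial s 1) =
      s.sum fun i m => MvPolynomial.monomial
        (s - Finsupp.single i 1 + Finsupp.single (i + n) 1) (m : K) := by
  rw [shiftD, MvPolynomial.mkDerivation_monomial, one_smul]
  refine Finset.sum_congr rfl fun i _ => ?_
  change MvPolynomial.monomial _ _ * MvPolynomial.X _ = _
  rw [MvPolynomial.X, MvPolynomial.monomial_mul, mul_one]

theorem sub_single_add {s : ℕ+ →₀ ℕ} {i : ℕ+} (hi : s i ≠ 0) :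
    s - Finsupp.single i 1 + Finsupp.single i 1 = s := by
  ext j
  by_cases h : j = i
  · subst h; simp; omega
  · simp [h]

theorem sub_single_add_eq_iff {s r : ℕ+ →₀ ℕ} {i k : ℕ+} (hi : s i ≠ 0) :
    s - Finsupp.single i 1 + Finsupp.single k 1 = r ↔
      s + Finsupp.single k 1 = r + Finsupp.single i 1 := by
  conv_rhs => rw [← sub_single_add hi, add_right_comm]
  exact (add_left_injective _).eq_iff.symm

/-- Multiplication by `p_n`, in `m̃`-coordinates. -/
def psumOp (K : Type*) [Field K] (n : ℕ+) : MvPolynomial ℕ+ K →ₗ[K] MvPolynomial ℕ+ K :=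
  LinearMap.mulLeft K (MvPolynomial.X n) + (shiftD K n).toLinearMap

theorem psumOp_apply {K : Type*} [Field K] (n : ℕ+) (P : MvPolynomial ℕ+ K) :
    psumOp K n P = MvPolynomial.X n * P + shiftD K n P := rfl

theorem key_count {K : Type*} [Field K] [CharZero K] (n : ℕ+) (s r : ℕ+ →₀ ℕ) :
    (r.sum fun k m => (m : K) * if (n : ℕ) ≤ (k : ℕ) then
        (if r + part (k - n) = s + part k then (fac s : K) else 0) else 0) =
      (fac r : K) * (psumOp K n (MvPolynomial.monomial s 1)).coeff r := by
  classical
  rw [psumOp_apply, shiftD_monomial, MvPolynomial.coeff_add, MvPolynomial.X,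
    MvPolynomial.monomial_mul, one_mul, MvPolynomial.coeff_monomial, Finsupp.sum, Finsupp.sum,
    MvPolynomial.coeff_sum]
  have hsplit : ∀ k ∈ r.support, ((r k : K) * if (n : ℕ) ≤ (k : ℕ) then
        (if r + part (k - n) = s + part k then (fac s : K) else 0) else 0) =
      (if k = n then (if Finsupp.single n 1 + s = r then (fac r : K) else 0) else 0) +
      (if n < k then (if r + part (k - n) = s + Finsupp.single k 1 then (r k * fac s : K) else 0)
        else 0) := by
    intro k _
    rcases lt_trichotomy k n with h | h | h
    · rw [if_neg (by rw [PNat.coe_le_coe]; exact not_le.2 h), if_neg h.ne, if_neg h.not_gt,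
        mul_zero, add_zero]
    · subst h
      rw [if_pos le_rfl, if_pos rfl, if_neg (lt_irrefl _), add_zero, Nat.sub_self, part_zero,
        add_zero, part_coe, mul_ite, mul_zero]
      by_cases h : r = s + Finsupp.single k 1
      · rw [if_pos h, if_pos (by rw [h, add_comm])]
        rw [h, fac_add_single]
        simp [mul_comm]
      · rw [if_neg h, if_neg (by rw [add_comm]; exact Ne.symm h)]
    · rw [if_pos (PNat.coe_le_coe _ _ |>.2 h.le), if_neg h.ne', if_pos h, zero_add, part_coe,
        mul_ite, mul_zero]
  rw [Finset.sum_congr rfl hsplit, Finset.sum_add_distrib, mul_add]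
  congr 1
  · rw [Finset.sum_ite_eq' r.support n, mul_ite, mul_one, mul_zero]
    by_cases h : Finsupp.single n 1 + s = r
    · rw [if_pos h, if_pos]
      rw [← h]; simp
    · rw [if_neg h, ite_self]
  · rw [Finset.mul_sum]
    have hR : ∀ i ∈ s.support, (fac r : K) * MvPolynomial.coeff r (MvPolynomial.monomial
        (s - Finsupp.single i 1 + Finsupp.single (i + n) 1) (s i : K)) =
        if s + Finsupp.single (i + n) 1 = r + Finsupp.single i 1 then (fac r : K) * s i else 0 := by
      intro i hi
      rw [MvPolynomial.coeff_monomial, mul_ite, mul_zero]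
      exact if_congr (sub_single_add_eq_iff (Finsupp.mem_support_iff.1 hi)) rfl rfl
    rw [Finset.sum_congr rfl hR]
    have hsub : ∀ i : ℕ+, part ((i + n : ℕ+) - n : ℕ) = Finsupp.single i 1 := by
      intro i
      rw [PNat.add_coe, Nat.add_sub_cancel, part_coe]
    have hne : ∀ i : ℕ+, i ≠ i + n := fun i h => by
      have := congrArg PNat.val h
      have h2 := n.pos
      have h3 := PNat.add_coe i n
      change (i : ℕ) = ((i + n : ℕ+) : ℕ) at this
      omega
    symm
    refine Finset.sum_bij_ne_zero (fun i _ _ => i + n) ?_ ?_ ?_ ?_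
    · intro i hi h
      have h1 : s + Finsupp.single (i + n) 1 = r + Finsupp.single i 1 := by
        by_contra h'; exact h (if_neg h')
      have h2 := DFunLike.congr_fun h1 (i + n)
      simp [(hne i).symm] at h2
      rw [Finsupp.mem_support_iff]; omega
    · intro i _ _ i' _ _ h
      exact add_right_cancel h
    · intro k hk h
      have hlt : n < k := by
        by_contra h'; exact h (if_neg h')
      obtain ⟨i, rfl⟩ : ∃ i : ℕ+, i + n = k := ⟨k - n, PNat.sub_add_of_lt hlt⟩
      rw [if_pos hlt, hsub] at h
      have h1 : s + Finsupp.single (i + n) 1 = r + Finsupp.single i 1 := by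
        by_contra h'; exact h (if_neg (Ne.symm h'))
      have h2 := DFunLike.congr_fun h1 i
      simp [hne i] at h2
      have hi : s i ≠ 0 := by omega
      refine ⟨i, Finsupp.mem_support_iff.2 hi, ?_, rfl⟩
      rw [if_pos h1]
      exact mul_ne_zero (Nat.cast_ne_zero.2 (fac_ne_zero r)) (Nat.cast_ne_zero.2 hi)
    · intro i hi h
      have h1 : s + Finsupp.single (i + n) 1 = r + Finsupp.single i 1 := by
        by_contra h'; exact h (if_neg h')
      rw [if_pos h1, if_pos (PNat.lt_add_left n i), hsub, if_pos h1.symm]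
      have h2 := DFunLike.congr_fun h1 i
      have h3 := DFunLike.congr_fun h1 (i + n)
      simp [hne i] at h2 h3
      have h4 := congrArg fac h1
      rw [fac_add_single, fac_add_single, h3, ← h2] at h4
      rw [← Nat.cast_mul, ← Nat.cast_mul, ← h4, mul_comm]

theorem psum_mul {K : Type*} [Field K] [CharZero K] (n : ℕ+) (P : MvPolynomial ℕ+ K) :
    psum K n * mTildeMap K P = mTildeMap K (psumOp K n P) := by
  have h : LinearMap.mulLeft K (psum K n) ∘ₗ mTildeMap K = mTildeMap K ∘ₗ psumOp K n := by
    refine (MvPolynomial.basisMonomials ℕ+ K).ext fun s => ?_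
    rw [MvPolynomial.coe_basisMonomials]
    apply Subtype.ext
    ext d
    have h1 : ((LinearMap.mulLeft K (psum K n) ∘ₗ mTildeMap K) (MvPolynomial.monomial s 1) :
        MvPowerSeries ℕ K) = psumSeries K n * (mTilde K s : MvPowerSeries ℕ K) := by
      rw [← mTildeMap_monomial]; rfl
    rw [h1, LinearMap.comp_apply, coeff_mTildeMap, ← key_count, coeff_psum_mul,
      ← sum_support_eq d (fun k => if (n : ℕ) ≤ k then
        (if shape d + part (k - n) = s + part k then (fac s : K) else 0) else 0)]
    refine Finset.sum_congr rfl fun j _ => ?_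
    have h2 := shape_update d j (d j - n)
    rw [coeff_mTilde, ← h2]
    simp only [add_left_inj]
  exact LinearMap.congr_fun h P


theorem shape_eq_zero_iff (d : ℕ →₀ ℕ) : shape d = 0 ↔ d = 0 := by
  constructor
  · intro h
    have := weight_shape d
    rw [h, map_zero] at this
    exact (Finsupp.degree_eq_zero_iff d).1 this.symm
  · rintro rfl; exact shape_zero

theorem mTildeMap_one (K : Type*) [Field K] : mTildeMap K 1 = 1 := by
  classical
  apply Subtype.ext
  ext d
  rw [coeff_mTildeMap, MvPolynomial.coeff_one]
  have h1 : ((1 : Lam K) : MvPowerSeries ℕ K) = 1 := rfl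
  rw [h1, MvPowerSeries.coeff_one]
  by_cases h : d = 0
  · rw [if_pos h, h, shape_zero, if_pos rfl]; simp [fac]
  · rw [if_neg h, if_neg, mul_zero]
    exact fun h' => h ((shape_eq_zero_iff d).1 h'.symm)

/-- The algebra map sending `X_n` to `p_n`, so that `∏ X_i ^ r_i` is sent to `p_λ`. -/
def psumMap (K : Type*) [Field K] : MvPolynomial ℕ+ K →ₐ[K] Lam K :=
  MvPolynomial.aeval (psum K)

/-- The transition map from power sums to `m̃`-coordinates. -/
def trans (K : Type*) [Field K] [CharZero K] : MvPolynomial ℕ+ K →ₗ[K] MvPolynomial ℕ+ K :=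
  (mTildeEquiv K).symm.toLinearMap ∘ₗ (psumMap K).toLinearMap

theorem mTildeMap_trans {K : Type*} [Field K] [CharZero K] (P : MvPolynomial ℕ+ K) :
    mTildeMap K (trans K P) = psumMap K P := (mTildeEquiv K).apply_symm_apply _

theorem trans_one (K : Type*) [Field K] [CharZero K] : trans K 1 = 1 :=
  (mTildeMap_bijective K).1 (by rw [mTildeMap_trans, map_one, mTildeMap_one])

theorem trans_X_mul {K : Type*} [Field K] [CharZero K] (n : ℕ+) (P : MvPolynomial ℕ+ K) :
    trans K (MvPolynomial.X n * P) = psumOp K n (trans K P) :=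
  (mTildeMap_bijective K).1 (by
    rw [mTildeMap_trans, ← psum_mul, mTildeMap_trans, map_mul, psumMap, MvPolynomial.aeval_X])

/-- Span of the monomials of degree less than `m`. -/
def lowDeg (K : Type*) [Field K] (m : ℕ) : Submodule K (MvPolynomial ℕ+ K) :=
  Submodule.span K {P | ∃ v : ℕ+ →₀ ℕ, v.degree < m ∧ P = MvPolynomial.monomial v 1}

theorem monomial_mem_lowDeg {K : Type*} [Field K] {m : ℕ} {v : ℕ+ →₀ ℕ} (h : v.degree < m)
    (c : K) : MvPolynomial.monomial v c ∈ lowDeg K m := by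
  have : MvPolynomial.monomial v c = c • MvPolynomial.monomial v (1 : K) := by
    rw [MvPolynomial.smul_monomial, smul_eq_mul, mul_one]
  rw [this]
  exact Submodule.smul_mem _ _ (Submodule.subset_span ⟨v, h, rfl⟩)

theorem lowDeg_mono {K : Type*} [Field K] {m m' : ℕ} (h : m ≤ m') : lowDeg K m ≤ lowDeg K m' :=
  Submodule.span_mono fun _ ⟨v, hv, e⟩ => ⟨v, hv.trans_le h, e⟩

theorem X_mul_mem {K : Type*} [Field K] (n : ℕ+) {m : ℕ} {P : MvPolynomial ℕ+ K}
    (h : P ∈ lowDeg K m) : MvPolynomial.X n * P ∈ lowDeg K (m + 1) := by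
  have : lowDeg K m ≤ (lowDeg K (m + 1)).comap (LinearMap.mulLeft K (MvPolynomial.X n)) := by
    refine Submodule.span_le.2 ?_
    rintro _ ⟨v, hv, rfl⟩
    change MvPolynomial.X n * MvPolynomial.monomial v 1 ∈ lowDeg K (m + 1)
    rw [MvPolynomial.X, MvPolynomial.monomial_mul]
    refine monomial_mem_lowDeg ?_ _
    rw [map_add, Finsupp.degree_single]; omega
  exact this h

theorem shiftD_monomial_mem {K : Type*} [Field K] (n : ℕ+) {m : ℕ} {v : ℕ+ →₀ ℕ}
    (h : v.degree < m) : shiftD K n (MvPolynomial.monomial v 1) ∈ lowDeg K m := by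
  rw [shiftD_monomial]
  refine Submodule.sum_mem _ fun i hi => monomial_mem_lowDeg ?_ _
  have h1 := congrArg Finsupp.degree (sub_single_add (Finsupp.mem_support_iff.1 hi))
  rw [map_add, Finsupp.degree_single] at h1 ⊢
  omega

theorem shiftD_mem {K : Type*} [Field K] (n : ℕ+) {m : ℕ} {P : MvPolynomial ℕ+ K}
    (h : P ∈ lowDeg K m) : shiftD K n P ∈ lowDeg K m := by
  have : lowDeg K m ≤ (lowDeg K m).comap (shiftD K n).toLinearMap := by
    refine Submodule.span_le.2 ?_
    rintro _ ⟨v, hv, rfl⟩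
    exact shiftD_monomial_mem n hv
  exact this h

theorem coeff_lowDeg {K : Type*} [Field K] {m : ℕ} {P : MvPolynomial ℕ+ K}
    (h : P ∈ lowDeg K m) {v : ℕ+ →₀ ℕ} (hv : m ≤ v.degree) : P.coeff v = 0 := by
  classical
  have : lowDeg K m ≤ LinearMap.ker (MvPolynomial.lcoeff K v) := by
    refine Submodule.span_le.2 ?_
    rintro _ ⟨u, hu, rfl⟩
    change MvPolynomial.coeff v (MvPolynomial.monomial u 1) = 0
    rw [MvPolynomial.coeff_monomial, if_neg]
    rintro rfl
    omega
  exact this h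

theorem trans_monomial_sub {K : Type*} [Field K] [CharZero K] (u : ℕ+ →₀ ℕ) :
    trans K (MvPolynomial.monomial u 1) - MvPolynomial.monomial u 1 ∈ lowDeg K u.degree := by
  have key : ∀ m : ℕ, ∀ u : ℕ+ →₀ ℕ, u.degree = m →
      trans K (MvPolynomial.monomial u 1) - MvPolynomial.monomial u 1 ∈ lowDeg K m := by
    intro m
    induction m with
    | zero =>
      intro u hu
      rw [(Finsupp.degree_eq_zero_iff u).1 hu]
      have : MvPolynomial.monomial (0 : ℕ+ →₀ ℕ) (1 : K) = 1 := rfl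
      rw [this, trans_one, sub_self]
      exact Submodule.zero_mem _
    | succ m ih =>
      intro u hu
      obtain ⟨n, hn⟩ : ∃ n, u n ≠ 0 := by
        by_contra! h
        have : u = 0 := Finsupp.ext h
        rw [this, map_zero] at hu
        omega
      have hd := congrArg Finsupp.degree (sub_single_add hn)
      rw [map_add, Finsupp.degree_single, hu] at hd
      have hv := ih (u - Finsupp.single n 1) (by omega)
      have hu' : MvPolynomial.monomial u (1 : K) =
          MvPolynomial.X n * MvPolynomial.monomial (u - Finsupp.single n 1) 1 := by
        rw [MvPolynomial.X, MvPolynomial.monomial_mul, add_comm, sub_single_add hn, mul_one]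
      rw [hu', trans_X_mul, psumOp_apply]
      set Q := MvPolynomial.monomial (u - Finsupp.single n 1) (1 : K) with hQ
      have e : MvPolynomial.X n * trans K Q + shiftD K n (trans K Q) - MvPolynomial.X n * Q =
          MvPolynomial.X n * (trans K Q - Q) + shiftD K n (trans K Q - Q) + shiftD K n Q := by
        rw [map_sub]; ring
      rw [e]
      refine Submodule.add_mem _ (Submodule.add_mem _ (X_mul_mem n hv)
        (lowDeg_mono (Nat.le_succ m) (shiftD_mem n hv))) (shiftD_monomial_mem n ?_)
      omega
  exact key _ u rfl

theorem trans_bijective (K : Type*) [Field K] [CharZero K] : Function.Bijective (trans K) := by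
  classical
  constructor
  · rw [injective_iff_map_eq_zero]
    intro P hP
    by_contra h0
    obtain ⟨u, hu, hmax⟩ := Finset.exists_max_image P.support Finsupp.degree
      (MvPolynomial.support_nonempty.2 h0)
    have h1 : (trans K P).coeff u = P.coeff u := by
      conv_lhs => rw [P.as_sum, map_sum, MvPolynomial.coeff_sum]
      rw [Finset.sum_eq_single u]
      · have : MvPolynomial.monomial u (P.coeff u) =
            P.coeff u • MvPolynomial.monomial u (1 : K) := by
          rw [MvPolynomial.smul_monomial, smul_eq_mul, mul_one]
        rw [this, map_smul, MvPolynomial.coeff_smul]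
        have h2 := coeff_lowDeg (trans_monomial_sub (K := K) u) (le_refl u.degree)
        rw [MvPolynomial.coeff_sub, sub_eq_zero, MvPolynomial.coeff_monomial, if_pos rfl] at h2
        rw [h2, smul_eq_mul, mul_one]
      · intro v hv hvu
        have : MvPolynomial.monomial v (P.coeff v) =
            P.coeff v • MvPolynomial.monomial v (1 : K) := by
          rw [MvPolynomial.smul_monomial, smul_eq_mul, mul_one]
        rw [this, map_smul, MvPolynomial.coeff_smul]
        have h2 := coeff_lowDeg (trans_monomial_sub (K := K) v) (hmax v hv)
        rw [MvPolynomial.coeff_sub, sub_eq_zero, MvPolynomial.coeff_monomial, if_neg hvu] at h2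
        rw [h2, smul_zero]
      · intro h; exact absurd hu h
    rw [hP, MvPolynomial.coeff_zero] at h1
    exact MvPolynomial.mem_support_iff.1 hu h1.symm
  · have key : ∀ m : ℕ, lowDeg K m ≤ LinearMap.range (trans K) := by
      intro m
      induction m with
      | zero =>
        refine Submodule.span_le.2 ?_
        rintro _ ⟨v, hv, rfl⟩
        exact absurd hv (Nat.not_lt_zero _)
      | succ m ih =>
        refine Submodule.span_le.2 ?_
        rintro _ ⟨v, hv, rfl⟩
        have h1 := ih (lowDeg_mono (Nat.lt_succ_iff.1 hv) (trans_monomial_sub (K := K) v))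
        have h2 := Submodule.sub_mem _ (LinearMap.mem_range_self (trans K)
          (MvPolynomial.monomial v 1)) h1
        rwa [sub_sub_cancel] at h2
    intro P
    have : P ∈ LinearMap.range (trans K) := by
      rw [P.as_sum]
      exact Submodule.sum_mem _ fun v _ => key (v.degree + 1)
        (monomial_mem_lowDeg (Nat.lt_succ_self _) _)
    exact this

/-- The power sums `p_1, p_2, …` are algebraically independent generators of the algebra of
symmetric functions; equivalently the `p_λ` form a basis. -/
def psumEquiv (K : Type*) [Field K] [CharZero K] : MvPolynomial ℕ+ K ≃ₐ[K] Lam K :=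
  AlgEquiv.ofBijective (psumMap K) (by
    have h : (psumMap K : MvPolynomial ℕ+ K → Lam K) = mTildeMap K ∘ trans K :=
      funext fun P => (mTildeMap_trans P).symm
    rw [h]
    exact (mTildeMap_bijective K).comp (trans_bijective K))

theorem psumEquiv_X {K : Type*} [Field K] [CharZero K] (n : ℕ+) :
    psumEquiv K (MvPolynomial.X n) = psum K n := MvPolynomial.aeval_X _ _

theorem psumEquiv_symm_psum {K : Type*} [Field K] [CharZero K] (n : ℕ+) :
    (psumEquiv K).symm (psum K n) = MvPolynomial.X n := by
  rw [← psumEquiv_X, AlgEquiv.symm_apply_apply]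

/-- The algebra homomorphism out of the algebra of symmetric functions with prescribed values on
the power sums `p_n`. -/
def liftPsum {K : Type*} [Field K] [CharZero K] {B : Type*} [CommRing B] [Algebra K B]
    (b : ℕ+ → B) : Lam K →ₐ[K] B :=
  (MvPolynomial.aeval b).comp (psumEquiv K).symm.toAlgHom

theorem liftPsum_psum {K : Type*} [Field K] [CharZero K] {B : Type*} [CommRing B] [Algebra K B]
    (b : ℕ+ → B) (n : ℕ+) : liftPsum b (psum K n) = b n := by
  change MvPolynomial.aeval b ((psumEquiv K).symm (psum K n)) = b n
  rw [psumEquiv_symm_psum, MvPolynomial.aeval_X]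

theorem lam_algHom_ext {K : Type*} [Field K] [CharZero K] {B : Type*} [Semiring B] [Algebra K B]
    {f g : Lam K →ₐ[K] B} (h : ∀ n, f (psum K n) = g (psum K n)) : f = g := by
  have h1 : f.comp (psumEquiv K).toAlgHom = g.comp (psumEquiv K).toAlgHom := by
    refine MvPolynomial.algHom_ext fun n => ?_
    change f (psumEquiv K (MvPolynomial.X n)) = g (psumEquiv K (MvPolynomial.X n))
    rw [psumEquiv_X, h]
  ext x
  obtain ⟨y, rfl⟩ := (psumEquiv K).surjective x
  exact DFunLike.congr_fun h1 y

/-- The counit: the constant coefficient, i.e. all variables are sent to `0`. -/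
def lamCounit (K : Type*) [Field K] : Lam K →ₐ[K] K where
  toFun f := MvPowerSeries.constantCoeff (f : MvPowerSeries ℕ K)
  map_one' := map_one MvPowerSeries.constantCoeff
  map_mul' _ _ := map_mul MvPowerSeries.constantCoeff _ _
  map_zero' := map_zero MvPowerSeries.constantCoeff
  map_add' _ _ := map_add MvPowerSeries.constantCoeff _ _
  commutes' c := by
    change MvPowerSeries.constantCoeff (algebraMap K (MvPowerSeries ℕ K) c) = c
    rw [MvPowerSeries.algebraMap_apply, MvPowerSeries.constantCoeff_C]
    rfl

theorem lamCounit_mTildeMap {K : Type*} [Field K] (P : MvPolynomial ℕ+ K) :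
    lamCounit K (mTildeMap K P) = P.coeff 0 := by
  have := coeff_mTildeMap P 0
  rw [shape_zero, MvPowerSeries.coeff_zero_eq_constantCoeff_apply] at this
  refine Eq.trans this ?_
  simp [fac]

theorem lamCounit_psum {K : Type*} [Field K] (n : ℕ+) : lamCounit K (psum K n) = 0 := by
  have h : lamCounit K (psum K n) = MvPowerSeries.coeff 0 (psumSeries K n) := by
    rw [MvPowerSeries.coeff_zero_eq_constantCoeff_apply]; rfl
  rw [h]
  simp only [MvPowerSeries.coeff_apply, psumSeries]
  rw [if_neg]
  rintro ⟨i, h⟩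
  have := DFunLike.congr_fun h i
  exact n.ne_zero (by simpa using this.symm)

/-- The coproduct: the algebra homomorphism with `Δ p_n = p_n ⊗ 1 + 1 ⊗ p_n`. -/
def lamComul (K : Type*) [Field K] [CharZero K] : Lam K →ₐ[K] Lam K ⊗[K] Lam K :=
  liftPsum fun n => psum K n ⊗ₜ[K] 1 + 1 ⊗ₜ[K] psum K n

theorem lamComul_psum {K : Type*} [Field K] [CharZero K] (n : ℕ+) :
    lamComul K (psum K n) = psum K n ⊗ₜ[K] 1 + 1 ⊗ₜ[K] psum K n := liftPsum_psum _ n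

instance lamBialgebra (K : Type*) [Field K] [CharZero K] : Bialgebra K (Lam K) :=
  Bialgebra.ofAlgHom (lamComul K) (lamCounit K)
    (lam_algHom_ext fun n => by
      simp [lamComul_psum, Algebra.TensorProduct.one_def, TensorProduct.add_tmul,
        TensorProduct.tmul_add]
      abel)
    (lam_algHom_ext fun n => by simp [lamComul_psum, lamCounit_psum])
    (lam_algHom_ext fun n => by simp [lamComul_psum, lamCounit_psum])

theorem comul_psum {K : Type*} [Field K] [CharZero K] (n : ℕ+) :
    Coalgebra.comul (R := K) (psum K n) = psum K n ⊗ₜ[K] 1 + 1 ⊗ₜ[K] psum K n :=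
  lamComul_psum n

theorem counit_psum {K : Type*} [Field K] [CharZero K] (n : ℕ+) :
    Coalgebra.counit (R := K) (psum K n) = 0 :=
  lamCounit_psum n

/-- The Hopf algebra of symmetric functions, with antipode `p_n ↦ -p_n`. -/
instance lamHopf (K : Type*) [Field K] [CharZero K] : HopfAlgebra K (Lam K) :=
  HopfAlgebra.ofAlgHom (liftPsum fun n => -psum K n)
    (lam_algHom_ext fun n => by
      simp only [AlgHom.comp_apply, Bialgebra.comulAlgHom_apply, comul_psum, map_add,
        Bialgebra.counitAlgHom_apply, counit_psum, map_zero]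
      change liftPsum (fun n => -psum K n) (psum K n) * 1 +
        liftPsum (fun n => -psum K n) 1 * psum K n = 0
      rw [liftPsum_psum, map_one]
      ring)
    (lam_algHom_ext fun n => by simp [comul_psum, liftPsum_psum, counit_psum])

/-- The vector space of symmetric functions, to be equipped with the product `⊙`. -/
def LamTilde (K : Type*) [Field K] : Type _ := Lam K

instance instTildeAddCommGroup (K : Type*) [Field K] : AddCommGroup (LamTilde K) :=
  inferInstanceAs (AddCommGroup (Lam K))

instance instTildeModule (K : Type*) [Field K] : Module K (LamTilde K) :=
  inferInstanceAs (Module K (Lam K))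

/-- The identity map, regarding a symmetric function as an element of `LamTilde K`. -/
def toTilde (K : Type*) [Field K] : Lam K ≃ₗ[K] LamTilde K := LinearEquiv.refl K (Lam K)

/-- The basis `m̃_λ` of `LamTilde K`, as an identification with polynomials in which the
monomial `∏ X_i ^ r_i(λ)` corresponds to `m̃_λ`. -/
def tildeEquiv (K : Type*) [Field K] [CharZero K] : MvPolynomial ℕ+ K ≃ₗ[K] LamTilde K :=
  (mTildeEquiv K).trans (toTilde K)

theorem tildeEquiv_monomial {K : Type*} [Field K] [CharZero K] (r : ℕ+ →₀ ℕ) :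
    tildeEquiv K (MvPolynomial.monomial r 1) = toTilde K (mTilde K r) :=
  congrArg (toTilde K) (mTildeMap_monomial r)

/-- The bilinear product `⊙`, determined by `m̃_λ ⊙ m̃_μ = m̃_{λ ⊔ μ}` (see `mTilde_odot`). -/
instance instTildeMul (K : Type*) [Field K] [CharZero K] :
    Mul (LamTilde K) :=
  ⟨fun a b => tildeEquiv K ((tildeEquiv K).symm a * (tildeEquiv K).symm b)⟩

instance instTildeOne (K : Type*) [Field K] [CharZero K] :
    One (LamTilde K) := ⟨toTilde K 1⟩

theorem tilde_mul_def {K : Type*} [Field K] [CharZero K] (a b : LamTilde K) :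
    a * b = tildeEquiv K ((tildeEquiv K).symm a * (tildeEquiv K).symm b) := rfl

theorem tildeEquiv_mul {K : Type*} [Field K] [CharZero K] (P Q : MvPolynomial ℕ+ K) :
    tildeEquiv K (P * Q) = tildeEquiv K P * tildeEquiv K Q := by
  rw [tilde_mul_def, LinearEquiv.symm_apply_apply, LinearEquiv.symm_apply_apply]

theorem tildeEquiv_one (K : Type*) [Field K] [CharZero K] : tildeEquiv K 1 = 1 :=
  congrArg (toTilde K) (mTildeMap_one K)

theorem tildeEquiv_symm_one (K : Type*) [Field K] [CharZero K] :
    (tildeEquiv K).symm 1 = 1 := by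
  rw [← tildeEquiv_one, LinearEquiv.symm_apply_apply]

theorem mTilde_odot {K : Type*} [Field K] [CharZero K] (r s : ℕ+ →₀ ℕ) :
    toTilde K (mTilde K r) * toTilde K (mTilde K s) = toTilde K (mTilde K (r + s)) := by
  rw [← tildeEquiv_monomial, ← tildeEquiv_monomial, ← tildeEquiv_mul, MvPolynomial.monomial_mul,
    one_mul, tildeEquiv_monomial]

instance instTildeCommRing (K : Type*) [Field K] [CharZero K] :
    CommRing (LamTilde K) where
  __ := (inferInstance : AddCommGroup (LamTilde K))
  mul_assoc a b c := by simp only [tilde_mul_def, LinearEquiv.symm_apply_apply, mul_assoc]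
  mul_comm a b := by simp only [tilde_mul_def, mul_comm]
  one_mul a := by
    rw [tilde_mul_def, tildeEquiv_symm_one, one_mul, LinearEquiv.apply_symm_apply]
  mul_one a := by
    rw [tilde_mul_def, tildeEquiv_symm_one, mul_one, LinearEquiv.apply_symm_apply]
  left_distrib a b c := by simp only [tilde_mul_def, map_add, mul_add]
  right_distrib a b c := by simp only [tilde_mul_def, map_add, add_mul]
  zero_mul a := by rw [tilde_mul_def, map_zero, zero_mul, map_zero]
  mul_zero a := by rw [tilde_mul_def, map_zero, mul_zero, map_zero]

instance instTildeAlgebra (K : Type*) [Field K] [CharZero K] :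
    Algebra K (LamTilde K) :=
  Algebra.ofModule
    (fun c a b => by
      rw [tilde_mul_def, tilde_mul_def, map_smul, smul_mul_assoc, map_smul])
    (fun c a b => by
      rw [tilde_mul_def, tilde_mul_def, map_smul, mul_smul_comm, map_smul])

/-- `LamTilde K` is a polynomial algebra in the `m̃_n`. -/
def tildeAlgEquiv (K : Type*) [Field K] [CharZero K] : MvPolynomial ℕ+ K ≃ₐ[K] LamTilde K :=
  AlgEquiv.ofLinearEquiv (tildeEquiv K) (tildeEquiv_one K) tildeEquiv_mul

/-- The coproduct and counit of `LamTilde K` are those of `Lam K`. -/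
instance instTildeCoalgebra (K : Type*) [Field K] [CharZero K] :
    Coalgebra K (LamTilde K) :=
  inferInstanceAs (Coalgebra K (Lam K))

theorem comul_toTilde {K : Type*} [Field K] [CharZero K] (f : Lam K) :
    Coalgebra.comul (R := K) (toTilde K f) =
      TensorProduct.map (toTilde K).toLinearMap (toTilde K).toLinearMap
        (Coalgebra.comul (R := K) f) := by
  have : TensorProduct.map (toTilde K).toLinearMap (toTilde K).toLinearMap =
    (LinearMap.id : (Lam K ⊗[K] Lam K) →ₗ[K] (Lam K ⊗[K] Lam K)) := TensorProduct.map_id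
  rw [this]
  rfl

theorem counit_toTilde {K : Type*} [Field K] [CharZero K] (f : Lam K) :
    Coalgebra.counit (R := K) (toTilde K f) = Coalgebra.counit (R := K) f := rfl

/-- The coproduct of a polynomial algebra with primitive generators. -/
def polyComul (K : Type*) [Field K] :
    MvPolynomial ℕ+ K →ₐ[K] MvPolynomial ℕ+ K ⊗[K] MvPolynomial ℕ+ K :=
  MvPolynomial.aeval fun n => MvPolynomial.X n ⊗ₜ[K] 1 + 1 ⊗ₜ[K] MvPolynomial.X n

theorem polyComul_X {K : Type*} [Field K] (n : ℕ+) :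
    polyComul K (MvPolynomial.X n) =
      MvPolynomial.X n ⊗ₜ[K] 1 + 1 ⊗ₜ[K] MvPolynomial.X n := MvPolynomial.aeval_X _ _

/-- `shiftD` acting on a tensor product by the Leibniz rule. -/
def shiftD2 (K : Type*) [Field K] (n : ℕ+) :
    MvPolynomial ℕ+ K ⊗[K] MvPolynomial ℕ+ K →ₗ[K] MvPolynomial ℕ+ K ⊗[K] MvPolynomial ℕ+ K :=
  TensorProduct.map (shiftD K n).toLinearMap LinearMap.id +
    TensorProduct.map LinearMap.id (shiftD K n).toLinearMap

theorem shiftD2_mul_X {K : Type*} [Field K] (n k : ℕ+)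
    (x : MvPolynomial ℕ+ K ⊗[K] MvPolynomial ℕ+ K) :
    shiftD2 K n (x * polyComul K (MvPolynomial.X k)) =
      shiftD2 K n x * polyComul K (MvPolynomial.X k) +
        x * polyComul K (MvPolynomial.X (k + n)) := by
  have hX : shiftD K n (MvPolynomial.X k) = MvPolynomial.X (k + n) :=
    MvPolynomial.mkDerivation_X _ _ _
  induction x using TensorProduct.induction_on with
  | zero => simp
  | add x y hx hy => rw [add_mul, map_add, hx, hy, map_add]; ring
  | tmul a b =>
    simp only [polyComul_X, shiftD2, mul_add, add_mul, Algebra.TensorProduct.tmul_mul_tmul, mul_one,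
      LinearMap.add_apply, TensorProduct.map_tmul, LinearMap.id_apply, map_add,
      Derivation.coeFn_coe, Derivation.leibniz, hX, smul_eq_mul, TensorProduct.add_tmul,
      TensorProduct.tmul_add, mul_comm (MvPolynomial.X k)]
    abel

theorem polyComul_shiftD {K : Type*} [Field K] (n : ℕ+) (P : MvPolynomial ℕ+ K) :
    polyComul K (shiftD K n P) = shiftD2 K n (polyComul K P) := by
  have hX : ∀ k, shiftD K n (MvPolynomial.X k) = MvPolynomial.X (k + n) :=
    fun k => MvPolynomial.mkDerivation_X _ _ _
  induction P using MvPolynomial.induction_on with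
  | C a =>
    have h : (MvPolynomial.C a : MvPolynomial ℕ+ K) = algebraMap K _ a := rfl
    rw [h, Derivation.map_algebraMap, map_zero, AlgHom.commutes, Algebra.TensorProduct.algebraMap_apply]
    simp only [shiftD2, LinearMap.add_apply, TensorProduct.map_tmul, LinearMap.id_apply,
      Derivation.coeFn_coe, Derivation.map_algebraMap, Derivation.map_one_eq_zero,
      TensorProduct.zero_tmul, TensorProduct.tmul_zero, add_zero]
  | add P Q hP hQ => rw [map_add, map_add, hP, hQ, map_add, map_add]
  | mul_X P k ih =>
    rw [Derivation.leibniz, hX, map_add, smul_eq_mul, smul_eq_mul, map_mul, map_mul, map_mul, ih,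
      shiftD2_mul_X]
    ring

theorem polyComul_psumOp {K : Type*} [Field K] (n : ℕ+) (P : MvPolynomial ℕ+ K) :
    polyComul K (psumOp K n P) =
      TensorProduct.map (psumOp K n) LinearMap.id (polyComul K P) +
        TensorProduct.map LinearMap.id (psumOp K n) (polyComul K P) := by
  rw [psumOp_apply, map_add, map_mul, polyComul_shiftD, polyComul_X]
  generalize polyComul K P = x
  induction x using TensorProduct.induction_on with
  | zero => simp
  | add x y hx hy =>
    simp only [mul_add, map_add] at hx hy ⊢
    linear_combination hx + hy
  | tmul a b =>
    simp only [shiftD2, add_mul, Algebra.TensorProduct.tmul_mul_tmul, one_mul,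
      LinearMap.add_apply, TensorProduct.map_tmul, LinearMap.id_apply, psumOp_apply,
      Derivation.coeFn_coe, TensorProduct.add_tmul, TensorProduct.tmul_add]
    abel

/-- In `m̃`-coordinates the coproduct makes every `m̃_n` primitive and is multiplicative for `⊙`. -/
theorem comul_mTildeMap {K : Type*} [Field K] [CharZero K] (P : MvPolynomial ℕ+ K) :
    Coalgebra.comul (R := K) (mTildeMap K P) =
      TensorProduct.map (mTildeMap K) (mTildeMap K) (polyComul K P) := by
  obtain ⟨Q, rfl⟩ := (trans_bijective K).2 P
  induction Q using MvPolynomial.induction_on with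
  | C a =>
    have h : trans K (MvPolynomial.C a) = a • 1 := by
      rw [MvPolynomial.C_eq_smul_one, map_smul, trans_one]
    rw [h, map_smul, map_smul, map_smul, map_smul, mTildeMap_one, Bialgebra.comul_one, map_one,
      Algebra.TensorProduct.one_def, Algebra.TensorProduct.one_def, TensorProduct.map_tmul,
      mTildeMap_one]
  | add P Q hP hQ => simp only [map_add, hP, hQ]
  | mul_X P n ih =>
    rw [mul_comm, trans_X_mul, ← psum_mul, Bialgebra.comul_mul, ih, comul_psum, polyComul_psumOp]
    generalize polyComul K (trans K P) = x
    induction x using TensorProduct.induction_on with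
    | zero => simp
    | add x y hx hy =>
      rw [map_add, mul_add, hx, hy]
      simp only [map_add]
      abel
    | tmul a b =>
      simp only [add_mul, Algebra.TensorProduct.tmul_mul_tmul, one_mul, map_add,
        TensorProduct.map_tmul, LinearMap.id_apply, psum_mul]

theorem comul_tildeAlgEquiv {K : Type*} [Field K] [CharZero K] (P : MvPolynomial ℕ+ K) :
    Coalgebra.comul (R := K) (tildeAlgEquiv K P) =
      Algebra.TensorProduct.map (tildeAlgEquiv K).toAlgHom (tildeAlgEquiv K).toAlgHom
        (polyComul K P) := by
  have h1 : tildeAlgEquiv K P = toTilde K (mTildeMap K P) := rfl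
  rw [h1, comul_toTilde, comul_mTildeMap, ← LinearMap.comp_apply, ← TensorProduct.map_comp]
  rfl

theorem counit_tildeAlgEquiv {K : Type*} [Field K] [CharZero K] (P : MvPolynomial ℕ+ K) :
    Coalgebra.counit (R := K) (tildeAlgEquiv K P) = MvPolynomial.constantCoeff P :=
  lamCounit_mTildeMap P

instance instTildeBialgebra (K : Type*) [Field K] [CharZero K] :
    Bialgebra K (LamTilde K) :=
  Bialgebra.mk' K (LamTilde K)
    (by rw [← map_one (tildeAlgEquiv K), counit_tildeAlgEquiv, map_one])
    (fun {a b} => by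
      obtain ⟨P, rfl⟩ := (tildeAlgEquiv K).surjective a
      obtain ⟨Q, rfl⟩ := (tildeAlgEquiv K).surjective b
      rw [← map_mul, counit_tildeAlgEquiv, counit_tildeAlgEquiv, counit_tildeAlgEquiv, map_mul])
    (by rw [← map_one (tildeAlgEquiv K), comul_tildeAlgEquiv, map_one, map_one])
    (fun {a b} => by
      obtain ⟨P, rfl⟩ := (tildeAlgEquiv K).surjective a
      obtain ⟨Q, rfl⟩ := (tildeAlgEquiv K).surjective b
      rw [← map_mul, comul_tildeAlgEquiv, comul_tildeAlgEquiv, comul_tildeAlgEquiv, map_mul,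
        map_mul])

theorem tilde_algHom_ext {K : Type*} [Field K] [CharZero K] {B : Type*} [Semiring B]
    [Algebra K B] {f g : LamTilde K →ₐ[K] B}
    (h : ∀ n, f (tildeAlgEquiv K (MvPolynomial.X n)) = g (tildeAlgEquiv K (MvPolynomial.X n))) :
    f = g := by
  have h1 : f.comp (tildeAlgEquiv K).toAlgHom = g.comp (tildeAlgEquiv K).toAlgHom :=
    MvPolynomial.algHom_ext h
  ext x
  obtain ⟨y, rfl⟩ := (tildeAlgEquiv K).surjective x
  exact DFunLike.congr_fun h1 y

theorem comul_mTilde_single {K : Type*} [Field K] [CharZero K] (n : ℕ+) :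
    Coalgebra.comul (R := K) (tildeAlgEquiv K (MvPolynomial.X n)) =
      tildeAlgEquiv K (MvPolynomial.X n) ⊗ₜ[K] 1 +
        1 ⊗ₜ[K] tildeAlgEquiv K (MvPolynomial.X n) := by
  rw [comul_tildeAlgEquiv, polyComul_X, map_add, Algebra.TensorProduct.map_tmul,
    Algebra.TensorProduct.map_tmul, map_one]
  rfl

/-- The antipode `m̃_n ↦ -m̃_n` of `LamTilde K`. -/
def tildeAntipode (K : Type*) [Field K] [CharZero K] : LamTilde K →ₐ[K] LamTilde K :=
  (MvPolynomial.aeval fun n => -tildeAlgEquiv K (MvPolynomial.X n)).comp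
    (tildeAlgEquiv K).symm.toAlgHom

theorem tildeAntipode_X {K : Type*} [Field K] [CharZero K] (n : ℕ+) :
    tildeAntipode K (tildeAlgEquiv K (MvPolynomial.X n)) =
      -tildeAlgEquiv K (MvPolynomial.X n) := by
  change MvPolynomial.aeval _ ((tildeAlgEquiv K).symm (tildeAlgEquiv K (MvPolynomial.X n))) = _
  rw [AlgEquiv.symm_apply_apply, MvPolynomial.aeval_X]

/-- The Hopf algebra of symmetric functions with the product `⊙` and the usual coproduct and
counit. -/
instance tildeHopf (K : Type*) [Field K] [CharZero K] : HopfAlgebra K (LamTilde K) :=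
  HopfAlgebra.ofAlgHom (tildeAntipode K)
    (tilde_algHom_ext fun n => by
      simp only [AlgHom.comp_apply, Bialgebra.comulAlgHom_apply, comul_mTilde_single, map_add,
        Bialgebra.counitAlgHom_apply, counit_tildeAlgEquiv, MvPolynomial.constantCoeff_X, map_zero]
      change tildeAntipode K (tildeAlgEquiv K (MvPolynomial.X n)) * 1 +
        tildeAntipode K 1 * tildeAlgEquiv K (MvPolynomial.X n) = 0
      rw [tildeAntipode_X, map_one]
      ring)
    (tilde_algHom_ext fun n => by
      simp only [AlgHom.comp_apply, Bialgebra.comulAlgHom_apply, comul_mTilde_single, map_add,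
        Bialgebra.counitAlgHom_apply, counit_tildeAlgEquiv, MvPolynomial.constantCoeff_X, map_zero]
      change tildeAlgEquiv K (MvPolynomial.X n) * tildeAntipode K 1 +
        1 * tildeAntipode K (tildeAlgEquiv K (MvPolynomial.X n)) = 0
      rw [tildeAntipode_X, map_one]
      ring)

end
end ChromSym

namespace ChromSym

noncomputable section

/-! Both Hopf algebras are polynomial algebras on primitive generators: the source on the `p_n`, the
target, with the product `⊙`, on the `m̃_n`. A morphism sends primitives to primitives, and in
characteristic zero the primitives of the target are the linear combinations of the `m̃_n`. So `φ`
becomes a substitution `polyHom φ` of polynomials with `X_n` sent to a linear form. It preserves the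
number of parts, though possibly not the size of a partition.

The two smallest graphs fix two values. For one vertex the chromatic function is `p_1 = m̃_1`, so
`X_1 ↦ X_1`. A connected graph on two vertices is an edge, with function `p_1² - p_2`, and its
complement has `p_1² = m̃_{11} + m̃_2`, so `X_2 ↦ -X_2`.

For a graph `G` with `m + 3` vertices, compare coefficients at `m̃_{3,1^m}` in `φ(X_G)` and the
function of the complement. On the complement side it counts stable triples of the complement, that
is, triangles of `G`. On the other side only `p_λ` with `|λ| = m + 3` and `m + 1` parts can
contribute, so `λ` is `(3,1^m)` or `(2,2,1^l)`. The latter is sent to `m̃_{2,2,1^l}`, because the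
two signs cancel, and contributes nothing (`coeff_hook_three_algHom`). What remains is `c` times the
`p_{3,1^m}`-coefficient of `X_G`. Inverting the change of basis at a few hooks
(`coeff_hook_three_trans`), that coefficient is the sum over all triples of vertices of an excess
equal to `0, 0, 1, 2` when the triple spans `0, 1, 2, 3` edges. Hence `c * (total excess) = (number
of triangles)` (`mul_sum_spanExcess`).

The graph on three vertices determines `c`: a path gives `c * 1 = 0`, a triangle gives `c * 2 = 1`.
If `c = 0`, no graph of the family has a triangle. If `c = 1/2`, the total excess is twice the
number of triangles. Since each triple has excess at least `2` if it is a triangle and at least `0`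
otherwise, no triple spans exactly two edges. A connected graph without induced path on three
vertices is complete. -/

/-! ### Change of basis from power sums to augmented monomials, at hooks -/

/-- A coefficient of `shiftD K k P`; the sum runs over the parts that may have been shifted. -/
theorem coeff_shiftD {K : Type*} [Field K] (k : ℕ+) (P : MvPolynomial ℕ+ K) (r : ℕ+ →₀ ℕ)
    (I : Finset ℕ+) (hI : ∀ i, r (i + k) ≠ 0 → i ∈ I) :
    (shiftD K k P).coeff r = ∑ i ∈ I, if r (i + k) ≠ 0 then
      (r i + 1 : K) * P.coeff (r - Finsupp.single (i + k) 1 + Finsupp.single i 1) else 0 := by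
  classical
  have hne : ∀ i : ℕ+, i ≠ i + k := fun i => (PNat.lt_add_right i k).ne
  induction P using MvPolynomial.induction_on' with
  | add P Q hP hQ =>
    rw [map_add, MvPolynomial.coeff_add, hP, hQ, ← Finset.sum_add_distrib]
    refine Finset.sum_congr rfl fun i _ => ?_
    split_ifs
    · rw [MvPolynomial.coeff_add, mul_add]
    · rw [add_zero]
  | monomial s a =>
    have h1 : MvPolynomial.monomial s a = a • MvPolynomial.monomial s (1 : K) := by
      rw [MvPolynomial.smul_monomial, smul_eq_mul, mul_one]
    have term : ∀ i, (if r (i + k) ≠ 0 then (r i + 1 : K) * MvPolynomial.coeff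
          (r - Finsupp.single (i + k) 1 + Finsupp.single i 1) (MvPolynomial.monomial s a) else 0) =
        a * MvPolynomial.coeff r (MvPolynomial.monomial
          (s - Finsupp.single i 1 + Finsupp.single (i + k) 1) (s i : K)) := by
      intro i
      rw [MvPolynomial.coeff_monomial, MvPolynomial.coeff_monomial]
      by_cases hs : s i = 0
      -- If `s` has no part `i`, both sides vanish: on the left the exponent has a part `i`, so it
      -- differs from `s`.
      · rw [hs, Nat.cast_zero, ite_self, mul_zero, if_neg (c := s = _), mul_zero, ite_self]
        rintro rfl
        simp at hs
      · by_cases hr : r (i + k) = 0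
        · rw [if_neg (not_not.2 hr), if_neg, mul_zero]
          rintro rfl
          simp at hr
        -- Both exponent conditions take the subtraction-free form `r + e_i = s + e_(i+k)`, from
        -- which also `s i = r i + 1`.
        · have e1 := sub_single_add_eq_iff (r := r) (k := i + k) hs
          have e2 := (sub_single_add_eq_iff (r := s) (k := i) hr).trans eq_comm
          rw [if_pos hr, if_congr (eq_comm.trans (e2.trans eq_comm)) rfl rfl,
            if_congr (e1.trans eq_comm) rfl rfl]
          by_cases h : r + Finsupp.single i 1 = s + Finsupp.single (i + k) 1
          · have h2 := DFunLike.congr_fun h i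
            simp only [Finsupp.add_apply, Finsupp.single_eq_same,
              Finsupp.single_eq_of_ne (hne i), add_zero] at h2
            rw [if_pos h, if_pos h, ← h2]
            push_cast
            ring
          · rw [if_neg h, if_neg h, mul_zero, mul_zero]
    simp only [term]
    rw [h1, Derivation.map_smul, MvPolynomial.coeff_smul, shiftD_monomial, Finsupp.sum,
      MvPolynomial.coeff_sum, smul_eq_mul, ← Finset.mul_sum]
    congr 1
    -- Both sums are extended to `s.support ∪ I`: outside the support the factor `s i` is zero, and
    -- outside `I` the exponent cannot equal `r`.
    refine (Finset.sum_subset (Finset.subset_union_left (s₂ := I)) fun i _ hi => ?_).trans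
      (Finset.sum_subset (Finset.subset_union_right (s₁ := s.support)) fun i _ hi => ?_).symm
    · rw [Finsupp.notMem_support_iff.1 hi, Nat.cast_zero, MvPolynomial.monomial_zero,
        MvPolynomial.coeff_zero]
    · rw [MvPolynomial.coeff_monomial, if_neg]
      rintro rfl
      exact hi (hI i (by simp))

/-- The exponent of `X_1 ^ m * X_k`, i.e. the partition with the part `k` and `m` parts `1`. -/
def hook (k : ℕ+) (m : ℕ) : ℕ+ →₀ ℕ := Finsupp.single 1 m + Finsupp.single k 1

/-- A shift creates a part `i + k ≥ 2`. -/
theorem coeff_ones_shiftD {K : Type*} [Field K] (k : ℕ+) (P : MvPolynomial ℕ+ K) (m : ℕ) :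
    (shiftD K k P).coeff (Finsupp.single 1 m) = 0 := by
  rw [coeff_shiftD k P _ ∅, Finset.sum_empty]
  intro i hi
  rw [Finsupp.single_apply_ne_zero] at hi
  have h1 := congrArg PNat.val hi.1
  have h2 := i.pos
  have h3 := k.pos
  rw [PNat.add_coe, PNat.val_ofNat] at h1
  omega

theorem hook_apply (k : ℕ+) (m : ℕ) (i : ℕ+) :
    hook k m i = (if (i : ℕ) = 1 then m else 0) + if (i : ℕ) = k then 1 else 0 := by
  rw [hook, Finsupp.add_apply, Finsupp.single_apply, Finsupp.single_apply]
  congr 1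
  · exact if_congr (by rw [← PNat.coe_inj, eq_comm, PNat.one_coe]) rfl rfl
  · exact if_congr (by rw [← PNat.coe_inj, eq_comm]) rfl rfl

theorem hook_apply_eq_zero {k : ℕ+} {m : ℕ} {i : ℕ+} (h1 : (i : ℕ) ≠ 1) (hk : (i : ℕ) ≠ k) :
    hook k m i = 0 := by
  rw [hook_apply, if_neg h1, if_neg hk]

/-- The part created by the shift is at least `2`, so it is the part `2`, which forces `i = k = 1`;
the factor is the number of `1`s available in `1^(m+1)`. -/
theorem coeff_hook_two_shiftD {K : Type*} [Field K] (k : ℕ+) (P : MvPolynomial ℕ+ K) (m : ℕ) :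
    (shiftD K k P).coeff (hook 2 m) =
      if k = 1 then (m + 1 : K) * P.coeff (Finsupp.single 1 (m + 1)) else 0 := by
  rw [coeff_shiftD k P _ {1}, Finset.sum_singleton]
  · by_cases hk : k = 1
    · subst hk
      have h2 : (1 + 1 : ℕ+) = 2 := rfl
      rw [if_pos rfl, h2, if_pos (by simp [hook_apply]), hook, add_tsub_cancel_right,
        ← Finsupp.single_add]
      simp
    · rw [if_neg hk, if_neg]
      have h1 := mt PNat.coe_inj.1 hk
      have h3 := k.pos
      rw [PNat.one_coe] at h1
      exact not_not.2 (hook_apply_eq_zero (by rw [PNat.add_coe, PNat.one_coe]; omega)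
        (by rw [PNat.add_coe, PNat.one_coe, PNat.val_ofNat]; omega))
  · intro i hi
    have h2 := i.pos
    have h3 := k.pos
    rw [Finset.mem_singleton, ← PNat.coe_inj, PNat.one_coe]
    contrapose! hi
    exact hook_apply_eq_zero (by rw [PNat.add_coe]; omega)
      (by rw [PNat.add_coe, PNat.val_ofNat]; omega)

/-- The created part must be the `3`: either a `2` is raised by `1`, or one of the `m + 1` ones is
raised by `2`. -/
theorem coeff_hook_three_shiftD {K : Type*} [Field K] (k : ℕ+) (P : MvPolynomial ℕ+ K) (m : ℕ) :
    (shiftD K k P).coeff (hook 3 m) = if k = 1 then P.coeff (hook 2 m) else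
      if k = 2 then (m + 1 : K) * P.coeff (Finsupp.single 1 (m + 1)) else 0 := by
  have h12 : (1 : ℕ+) ≠ 2 := by decide
  have hval : ∀ i : ℕ+, hook 3 m (i + k) ≠ 0 ↔ (i : ℕ) + k = 3 := by
    intro i
    have h2 := i.pos
    have h3 := k.pos
    rw [hook_apply, PNat.add_coe, PNat.val_ofNat, if_neg (by omega), zero_add]
    simp
  have hI : ∀ i : ℕ+, hook 3 m (i + k) ≠ 0 → i ∈ ({1, 2} : Finset ℕ+) := by
    intro i hi
    have h2 := i.pos
    have h3 := k.pos
    have := (hval i).1 hi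
    rw [Finset.mem_insert, Finset.mem_singleton, ← PNat.coe_inj, ← PNat.coe_inj, PNat.one_coe,
      PNat.val_ofNat]
    omega
  rw [coeff_shiftD k P _ _ hI, Finset.sum_pair h12, if_congr (hval 1) rfl rfl,
    if_congr (hval 2) rfl rfl]
  by_cases hk : k = 1
  · subst hk
    have h : (2 + 1 : ℕ+) = 3 := rfl
    rw [if_pos rfl, if_neg (by simp), if_pos (by simp), zero_add, h, hook, add_tsub_cancel_right]
    simp [hook]
  · rw [if_neg hk]
    by_cases hk2 : k = 2
    · subst hk2
      have h : (1 + 2 : ℕ+) = 3 := rfl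
      rw [if_pos rfl, if_pos (by simp), if_neg (by simp), add_zero, h, hook,
        add_tsub_cancel_right, ← Finsupp.single_add]
      simp
    · have h1 := mt PNat.coe_inj.1 hk
      have h2 := mt PNat.coe_inj.1 hk2
      rw [PNat.one_coe] at h1
      rw [PNat.val_ofNat] at h2
      rw [if_neg hk2, if_neg (by rw [PNat.one_coe]; omega), if_neg (by rw [PNat.val_ofNat]; omega),
        add_zero]

theorem coeff_ones_X_mul {K : Type*} [Field K] (k : ℕ+) (P : MvPolynomial ℕ+ K) (m : ℕ) :
    (MvPolynomial.X k * P).coeff (Finsupp.single 1 m) =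
      if k = 1 ∧ m ≠ 0 then P.coeff (Finsupp.single 1 (m - 1)) else 0 := by
  classical
  rw [MvPolynomial.coeff_X_mul']
  by_cases hk : k = 1
  · subst hk
    simp [← Finsupp.single_tsub]
  · simp [hk]

theorem coeff_hook_X_mul {K : Type*} [Field K] (j k : ℕ+)
    (P : MvPolynomial ℕ+ K) (m : ℕ) :
    (MvPolynomial.X k * P).coeff (hook j m) = if k = j then P.coeff (Finsupp.single 1 m) else
      if k = 1 ∧ m ≠ 0 then P.coeff (hook j (m - 1)) else 0 := by
  classical
  by_cases hk : k = j
  · rw [if_pos hk, hk, hook, add_comm, MvPolynomial.coeff_X_mul]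
  · rw [if_neg hk]
    by_cases h : k = 1 ∧ m ≠ 0
    · obtain ⟨rfl, hm⟩ := h
      obtain ⟨m, rfl⟩ := Nat.exists_eq_succ_of_ne_zero hm
      have e : hook j (m + 1) = Finsupp.single 1 1 + hook j m := by
        rw [hook, hook, Finsupp.single_add]
        abel
      rw [if_pos ⟨rfl, hm⟩, Nat.succ_eq_add_one, e, MvPolynomial.coeff_X_mul, Nat.add_sub_cancel]
    · rw [if_neg h, MvPolynomial.coeff_X_mul', if_neg]
      rw [Finsupp.notMem_support_iff, hook_apply, if_neg (c := (k : ℕ) = j) (mt PNat.coe_inj.1 hk),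
        add_zero]
      by_cases hk1 : k = 1
      · rw [not_and_or, not_not] at h
        simp [h.resolve_left (not_not.2 hk1)]
      · exact if_neg fun h' => hk1 (PNat.coe_inj.1 h')

/-- Expanding a `p_λ` in the `m̃_μ` sums over all ways to merge parts of `λ`. A partition into `1`s
arises only from itself, without merging. The two hook formulas below rest on the same picture; all
three are proved by induction through `trans_X_mul`. -/
theorem coeff_ones_trans {K : Type*} [Field K] [CharZero K] (P : MvPolynomial ℕ+ K) (m : ℕ) :
    (trans K P).coeff (Finsupp.single 1 m) = P.coeff (Finsupp.single 1 m) := by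
  induction P using MvPolynomial.induction_on generalizing m with
  | C a => rw [MvPolynomial.C_eq_smul_one, map_smul, trans_one]
  | add P Q hP hQ => rw [map_add, MvPolynomial.coeff_add, hP, hQ, MvPolynomial.coeff_add]
  | mul_X P k ih =>
    rw [mul_comm, trans_X_mul, psumOp_apply, MvPolynomial.coeff_add, coeff_ones_shiftD, add_zero,
      coeff_ones_X_mul, coeff_ones_X_mul, ih]

theorem coeff_one_hook {K : Type*} [Field K] (k : ℕ+) (m : ℕ) :
    (1 : MvPolynomial ℕ+ K).coeff (hook k m) = 0 := by
  classical
  rw [MvPolynomial.coeff_one, if_neg]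
  intro h
  have := DFunLike.congr_fun h k
  simp [hook] at this

/-- The part `2` is either already present or obtained by merging two of `m + 2` ones. -/
theorem coeff_hook_two_trans {K : Type*} [Field K] [CharZero K] (P : MvPolynomial ℕ+ K) (m : ℕ) :
    (trans K P).coeff (hook 2 m) =
      P.coeff (hook 2 m) + (m + 2).choose 2 * P.coeff (Finsupp.single 1 (m + 2)) := by
  induction P using MvPolynomial.induction_on generalizing m with
  | C a =>
    rw [MvPolynomial.C_eq_smul_one, map_smul, trans_one, MvPolynomial.coeff_smul, coeff_one_hook,
      MvPolynomial.coeff_smul, MvPolynomial.coeff_one, if_neg]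
    · simp
    · rw [eq_comm, Finsupp.single_eq_zero]; omega
  | add P Q hP hQ =>
    simp only [map_add, MvPolynomial.coeff_add, hP, hQ]
    ring
  | mul_X P k ih =>
    have h2 : (2 : ℕ+) ≠ 1 := by decide
    rw [mul_comm, trans_X_mul, psumOp_apply, MvPolynomial.coeff_add, coeff_hook_two_shiftD,
      coeff_hook_X_mul, coeff_hook_X_mul, coeff_ones_X_mul, coeff_ones_trans,
      coeff_ones_trans]
    by_cases hk : k = 1
    · subst hk
      cases m with
      | zero => simp [h2.symm]
      | succ m =>
        -- Pascal's rule: the new `1` either stays out of the merged pair or is merged with one of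
        -- the `m + 2` others.
        have h3 : (m + 3).choose 2 = (m + 2).choose 2 + (m + 2) := by
          rw [Nat.choose_succ_succ' (m + 2) 1, Nat.choose_one_right, add_comm]
        simp only [h2.symm, ih, h3, if_false, if_true, ne_eq, Nat.add_eq_zero_iff, one_ne_zero,
          OfNat.ofNat_ne_zero, and_false, not_false_eq_true, and_self, Nat.add_sub_cancel]
        push_cast
        ring_nf
    · simp [hk]

/-- The part `3` is present, or comes from the `2` and one of `m + 1` ones, or from three of `m + 3`
ones. -/
theorem coeff_hook_three_trans {K : Type*} [Field K] [CharZero K] (P : MvPolynomial ℕ+ K) (m : ℕ) :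
    (trans K P).coeff (hook 3 m) =
      P.coeff (hook 3 m) + (m + 1) * P.coeff (hook 2 (m + 1)) +
        (m + 3).choose 3 * P.coeff (Finsupp.single 1 (m + 3)) := by
  induction P using MvPolynomial.induction_on generalizing m with
  | C a =>
    rw [MvPolynomial.C_eq_smul_one, map_smul, trans_one, MvPolynomial.coeff_smul, coeff_one_hook,
      MvPolynomial.coeff_smul, coeff_one_hook, MvPolynomial.coeff_smul, MvPolynomial.coeff_one,
      if_neg]
    · simp
    · rw [eq_comm, Finsupp.single_eq_zero]; omega
  | add P Q hP hQ =>
    simp only [map_add, MvPolynomial.coeff_add, hP, hQ]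
    ring
  | mul_X P k ih =>
    have h2 : (2 : ℕ+) ≠ 1 := by decide
    have h3 : (3 : ℕ+) ≠ 1 := by decide
    have h23 : (2 : ℕ+) ≠ 3 := by decide
    rw [mul_comm, trans_X_mul, psumOp_apply, MvPolynomial.coeff_add, coeff_hook_three_shiftD,
      coeff_hook_X_mul, coeff_hook_X_mul, coeff_hook_X_mul, coeff_ones_X_mul,
      coeff_ones_trans, coeff_ones_trans, coeff_hook_two_trans]
    by_cases hk : k = 1
    · subst hk
      cases m with
      | zero => simp [h2.symm, h3.symm]
      | succ m =>
        have h4 : (m + 4).choose 3 = (m + 3).choose 2 + (m + 3).choose 3 :=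
          Nat.choose_succ_succ' (m + 3) 2
        simp only [h2.symm, h3.symm, ih, h4, if_false, if_true, ne_eq, Nat.add_eq_zero_iff,
          one_ne_zero, OfNat.ofNat_ne_zero, and_false, not_false_eq_true, and_self, Nat.add_sub_cancel]
        push_cast
        ring_nf
    · by_cases hk2 : k = 2
      · subst hk2
        simp [h2, h23]
      · simp [hk, hk2]

/-! ### The change of basis respects the size of partitions -/

/-- The size of a part; `Finsupp.weight partSize r` is the size of the partition `r`. -/
abbrev partSize : ℕ+ → ℕ := fun i => (i : ℕ)

theorem X_mul_isWeightedHomogeneous {K : Type*} [Field K] (n : ℕ+) {P : MvPolynomial ℕ+ K} {m : ℕ}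
    (hP : P.IsWeightedHomogeneous partSize m) :
    (MvPolynomial.X n * P).IsWeightedHomogeneous partSize (n + m) :=
  (MvPolynomial.isWeightedHomogeneous_X K partSize n).mul hP

/-- Replacing a part `i` by `i + n` raises the size by `n`, just as adding a part `n` does. -/
theorem shiftD_isWeightedHomogeneous {K : Type*} [Field K] (n : ℕ+) {P : MvPolynomial ℕ+ K} {m : ℕ}
    (hP : P.IsWeightedHomogeneous partSize m) :
    (shiftD K n P).IsWeightedHomogeneous partSize (n + m) := by
  intro r hr
  classical
  rw [P.as_sum, map_sum, MvPolynomial.coeff_sum] at hr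
  obtain ⟨s, hs, h⟩ := Finset.exists_ne_zero_of_sum_ne_zero hr
  have hw := hP (MvPolynomial.mem_support_iff.1 hs)
  have h1 : MvPolynomial.monomial s (P.coeff s) = P.coeff s • MvPolynomial.monomial s (1 : K) := by
    rw [MvPolynomial.smul_monomial, smul_eq_mul, mul_one]
  rw [h1, Derivation.map_smul, MvPolynomial.coeff_smul, shiftD_monomial, Finsupp.sum,
    MvPolynomial.coeff_sum] at h
  obtain ⟨i, hi, h2⟩ := Finset.exists_ne_zero_of_sum_ne_zero (right_ne_zero_of_mul h)
  rw [MvPolynomial.coeff_monomial] at h2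
  have h3 := of_not_not fun hn => h2 (if_neg hn)
  have h4 := congrArg (Finsupp.weight partSize)
    ((sub_single_add_eq_iff (Finsupp.mem_support_iff.1 hi)).1 h3)
  rw [map_add, map_add, Finsupp.weight_single, Finsupp.weight_single, hw, one_smul, one_smul] at h4
  have h5 : partSize (i + n) = partSize i + n := PNat.add_coe i n
  omega

theorem trans_monomial_isWeightedHomogeneous {K : Type*} [Field K] [CharZero K] (u : ℕ+ →₀ ℕ) :
    (trans K (MvPolynomial.monomial u 1)).IsWeightedHomogeneous partSize
      (Finsupp.weight partSize u) := by
  induction hm : u.degree generalizing u with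
  | zero =>
    rw [(Finsupp.degree_eq_zero_iff u).1 hm]
    have : MvPolynomial.monomial (0 : ℕ+ →₀ ℕ) (1 : K) = 1 := rfl
    rw [this, trans_one, map_zero]
    exact MvPolynomial.isWeightedHomogeneous_one K partSize
  | succ m ih =>
    obtain ⟨n, hn⟩ : ∃ n, u n ≠ 0 := by
      by_contra! h
      rw [show u = 0 from Finsupp.ext h, map_zero] at hm
      omega
    obtain ⟨v, rfl⟩ : ∃ v, u = Finsupp.single n 1 + v :=
      ⟨u - Finsupp.single n 1, by rw [add_comm, sub_single_add hn]⟩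
    rw [map_add, Finsupp.degree_single] at hm
    have e : MvPolynomial.monomial (Finsupp.single n 1 + v) (1 : K) =
        MvPolynomial.X n * MvPolynomial.monomial v 1 := by
      rw [MvPolynomial.X, MvPolynomial.monomial_mul, mul_one]
    have hv := ih v (by omega)
    rw [e, trans_X_mul, psumOp_apply, map_add, Finsupp.weight_single, one_smul]
    exact (X_mul_isWeightedHomogeneous n hv).add (shiftD_isWeightedHomogeneous n hv)

theorem trans_weightedHomogeneousComponent {K : Type*} [Field K] [CharZero K] (n : ℕ)
    (P : MvPolynomial ℕ+ K) :
    trans K (MvPolynomial.weightedHomogeneousComponent partSize n P) =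
      MvPolynomial.weightedHomogeneousComponent partSize n (trans K P) := by
  classical
  have h : trans K ∘ₗ MvPolynomial.weightedHomogeneousComponent partSize n =
      MvPolynomial.weightedHomogeneousComponent partSize n ∘ₗ trans K := by
    refine (MvPolynomial.basisMonomials ℕ+ K).ext fun s => ?_
    rw [MvPolynomial.coe_basisMonomials, LinearMap.comp_apply, LinearMap.comp_apply,
      MvPolynomial.weightedHomogeneousComponent_of_mem (trans_monomial_isWeightedHomogeneous s),
      MvPolynomial.weightedHomogeneousComponent_of_mem
        (MvPolynomial.isWeightedHomogeneous_monomial partSize s 1 rfl)]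
    split_ifs
    · rfl
    · rw [map_zero]
  exact LinearMap.congr_fun h P

/-- `trans` is injective and commutes with taking homogeneous components, so a polynomial with
homogeneous image equals its own component. -/
theorem isWeightedHomogeneous_of_trans {K : Type*} [Field K] [CharZero K] {n : ℕ}
    {P : MvPolynomial ℕ+ K} (h : (trans K P).IsWeightedHomogeneous partSize n) :
    P.IsWeightedHomogeneous partSize n := by
  have h1 : MvPolynomial.weightedHomogeneousComponent partSize n P = P :=
    (trans_bijective K).1 (by
      rw [trans_weightedHomogeneousComponent, h.weightedHomogeneousComponent_same])
  rw [← h1]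
  exact MvPolynomial.weightedHomogeneousComponent_isWeightedHomogeneous n P

/-! ### Primitive elements of the target -/

theorem coeff_aeval_smul_X {K : Type*} [Field K] (a : K) (P : MvPolynomial ℕ+ K) (v : ℕ+ →₀ ℕ) :
    (MvPolynomial.aeval (fun n : ℕ+ => a • (MvPolynomial.X n : MvPolynomial ℕ+ K)) P).coeff v =
      a ^ v.degree * P.coeff v := by
  classical
  induction P using MvPolynomial.induction_on' with
  | add P Q hP hQ => rw [map_add, MvPolynomial.coeff_add, MvPolynomial.coeff_add, hP, hQ, mul_add]
  | monomial s b =>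
    have : MvPolynomial.aeval (fun n : ℕ+ => a • (MvPolynomial.X n : MvPolynomial ℕ+ K))
        (MvPolynomial.monomial s b) = MvPolynomial.monomial s (a ^ s.degree * b) := by
      rw [MvPolynomial.aeval_monomial]
      simp only [MvPolynomial.smul_eq_C_mul, mul_pow]
      rw [Finsupp.prod_mul, MvPolynomial.monomial_eq, MvPolynomial.algebraMap_eq, map_mul,
        Finsupp.degree_apply, Finsupp.prod, Finset.prod_pow_eq_pow_sum, map_pow]
      ring
    rw [this, MvPolynomial.coeff_monomial, MvPolynomial.coeff_monomial]
    split_ifs with h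
    · rw [h]
    · rw [mul_zero]

/-- In characteristic zero a primitive element of `LamTilde K` is a combination of the `m̃_n`. -/
theorem isHomogeneous_of_primitive {K : Type*} [Field K] [CharZero K] {f : LamTilde K}
    (h : Coalgebra.comul (R := K) f = f ⊗ₜ[K] 1 + 1 ⊗ₜ[K] f) :
    ((tildeAlgEquiv K).symm f).IsHomogeneous 1 := by
  obtain ⟨P, rfl⟩ := (tildeAlgEquiv K).surjective f
  rw [AlgEquiv.symm_apply_apply]
  -- Multiplying the two tensor factors together turns primitivity into `(μ ∘ Δ) f = 2f`. On the
  -- polynomial algebra `μ ∘ Δ` is the substitution `X_n ↦ 2 X_n`, which scales degree `d` by `2^d`;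
  -- so only degree `1` survives.
  have h1 := congrArg (Algebra.TensorProduct.lmul' K (S := LamTilde K)) h
  rw [comul_tildeAlgEquiv, map_add, Algebra.TensorProduct.lmul'_apply_tmul,
    Algebra.TensorProduct.lmul'_apply_tmul, mul_one, one_mul, ← map_add] at h1
  have h2 : (((Algebra.TensorProduct.lmul' K (S := LamTilde K)).comp
      (Algebra.TensorProduct.map (tildeAlgEquiv K).toAlgHom (tildeAlgEquiv K).toAlgHom)).comp
      (polyComul K)) = (tildeAlgEquiv K).toAlgHom.comp
      (MvPolynomial.aeval fun n : ℕ+ => (2 : K) • (MvPolynomial.X n : MvPolynomial ℕ+ K)) := by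
    refine MvPolynomial.algHom_ext fun n => ?_
    simp [polyComul_X, two_smul]
  have h3 : MvPolynomial.aeval (fun n : ℕ+ => (2 : K) • (MvPolynomial.X n : MvPolynomial ℕ+ K)) P =
      P + P := (tildeAlgEquiv K).injective ((AlgHom.congr_fun h2 P).symm.trans h1)
  intro v hv
  have h4 := congrArg (MvPolynomial.coeff v) h3
  rw [coeff_aeval_smul_X, MvPolynomial.coeff_add, ← two_mul] at h4
  have h5 := mul_right_cancel₀ hv h4
  have h6 : 2 ^ v.degree = 2 ^ 1 := by exact_mod_cast h5
  exact (DFunLike.congr_fun (Finsupp.degree_eq_weight_one (R := ℕ)) v).symm.trans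
    (Nat.pow_right_injective le_rfl h6)

/-! ### Coefficients of the chromatic symmetric function at hooks count stable sets -/

theorem shape_add_single {d : ℕ →₀ ℕ} {j : ℕ} (hj : d j = 0) (k : ℕ) :
    shape (d + Finsupp.single j k) = shape d + part k := by
  have h := shape_update d j k
  rw [hj, part_zero, add_zero] at h
  rw [← h]
  congr 1
  ext i
  by_cases hi : i = j
  · subst hi; simp [hj]
  · simp [hi]

/-- The exponent of `x_0 ^ k * x_1 * ⋯ * x_m`. -/
def hookContent (k m : ℕ) : ℕ →₀ ℕ :=
  Finsupp.single 0 k + ∑ j : Fin m, Finsupp.single ((j : ℕ) + 1) 1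

theorem hookContent_zero (k m : ℕ) : hookContent k m 0 = k := by
  simp [hookContent]

theorem hookContent_succ (k m j : ℕ) : hookContent k m (j + 1) = if j < m then 1 else 0 := by
  rw [hookContent, Finsupp.add_apply, Finsupp.single_apply, if_neg (by omega), zero_add,
    Finsupp.finsetSum_apply]
  simp only [Finsupp.single_apply, add_left_inj]
  split_ifs with h
  · rw [Finset.sum_eq_single ⟨j, h⟩]
    · simp
    · rintro ⟨i, hi⟩ _ hne
      exact if_neg fun h' => hne (Fin.ext h')
    · simp
  · exact Finset.sum_eq_zero fun i _ => if_neg fun h' : (i : ℕ) = j => h (h' ▸ i.2)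

theorem shape_hookContent (k : ℕ+) (m : ℕ) : shape (hookContent k m) = hook k m := by
  induction m with
  | zero =>
    have h := shape_add_single (d := 0) (j := 0) rfl (k : ℕ)
    rw [zero_add, shape_zero, zero_add, part_coe] at h
    simp [hookContent, hook, h]
  | succ m ih =>
    have e : hookContent k (m + 1) = hookContent k m + Finsupp.single (m + 1) 1 := by
      rw [hookContent, hookContent, Fin.sum_univ_castSucc, add_assoc]
      rfl
    have h1 : part 1 = Finsupp.single 1 1 := part_coe 1
    rw [e, shape_add_single (by rw [hookContent_succ, if_neg (lt_irrefl m)]), ih, h1, hook, hook,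
      Finsupp.single_add]
    abel

theorem sum_single_apply {V : Type*} [Fintype V] (κ : V → ℕ) (j : ℕ) :
    (∑ v, Finsupp.single (κ v) 1 : ℕ →₀ ℕ) j = (Finset.univ.filter fun v => κ v = j).card := by
  rw [Finsupp.finsetSum_apply, Finset.card_filter]
  exact Finset.sum_congr rfl fun v _ => Finsupp.single_apply

/-- The number of stable sets of `k` vertices. -/
def indepCount {V : Type*} [Fintype V] (G : SimpleGraph V) (k : ℕ) : ℕ :=
  open Classical in (Finset.univ.filter fun T : Finset V => T.card = k ∧ G.IsIndepSet T).card

/-- The colouring in which `T` gets the colour `0` and the other vertices get the distinct colours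
`1, …, m`. -/
def hookColoring {V : Type*} {G : SimpleGraph V} {m : ℕ} (T : Finset V)
    (hT : G.IsIndepSet (T : Set V)) (e : {v // v ∉ T} ≃ Fin m) : G.Coloring ℕ :=
  open Classical in SimpleGraph.Coloring.mk
    (fun v => if h : v ∈ T then 0 else (e ⟨v, h⟩ : ℕ) + 1) (by
      intro v w hvw
      by_cases hv : v ∈ T <;> by_cases hw : w ∈ T
      · exact absurd hvw (hT hv hw hvw.ne)
      · simp [hv, hw]
      · simp [hv, hw]
      · simp only [hv, hw, dif_neg, not_false_eq_true, ne_eq, add_left_inj]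
        intro h
        exact hvw.ne (congrArg Subtype.val (e.injective (Fin.ext h))))

theorem hookColoring_of_mem {V : Type*} {G : SimpleGraph V} {m : ℕ} {T : Finset V}
    (hT : G.IsIndepSet (T : Set V)) (e : {v // v ∉ T} ≃ Fin m) {v : V} (hv : v ∈ T) :
    hookColoring T hT e v = 0 := dif_pos hv

theorem hookColoring_of_notMem {V : Type*} {G : SimpleGraph V} {m : ℕ} {T : Finset V}
    (hT : G.IsIndepSet (T : Set V)) (e : {v // v ∉ T} ≃ Fin m) {v : V} (hv : v ∉ T) :
    hookColoring T hT e v = e ⟨v, hv⟩ + 1 := dif_neg hv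

theorem sum_hookColoring {V : Type*} [Fintype V] {G : SimpleGraph V} {m : ℕ} {T : Finset V}
    (hT : G.IsIndepSet (T : Set V)) (e : {v // v ∉ T} ≃ Fin m) :
    (∑ v, Finsupp.single (hookColoring T hT e v) 1 : ℕ →₀ ℕ) = hookContent T.card m := by
  classical
  rw [hookContent, ← Finset.sum_add_sum_compl T]
  congr 1
  · rw [Finset.sum_congr rfl fun v hv => by rw [hookColoring_of_mem hT e hv], Finset.sum_const,
      Finsupp.smul_single, smul_eq_mul, mul_one]
  · rw [← e.sum_comp, Finset.sum_subtype Tᶜ (p := fun v => v ∉ T) (by simp)]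
    exact Finset.sum_congr rfl fun v _ => by rw [hookColoring_of_notMem hT e v.2]

/-- Such a colouring amounts to its colour class `0`, a stable set of size `k`, together with a
bijection from the other vertices to the colours `1, …, m`, each used once. -/
theorem card_hook_colorings {V : Type*} [Fintype V] (G : SimpleGraph V) {k m : ℕ}
    (hV : Fintype.card V = m + k) :
    Nat.card {κ : G.Coloring ℕ // ∑ v, Finsupp.single (κ v) (((fun _ => 1 : V → ℕ+) v : ℕ+) : ℕ) =
      hookContent k m} = indepCount G k * m.factorial := by
  classical
  let F : (Σ T : {T : Finset V // T.card = k ∧ G.IsIndepSet T}, ({v // v ∉ T.1} ≃ Fin m)) →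
      {κ : G.Coloring ℕ // ∑ v, Finsupp.single (κ v) (((fun _ => 1 : V → ℕ+) v : ℕ+) : ℕ) =
        hookContent k m} := fun x => ⟨hookColoring x.1.1 x.1.2.2 x.2,
          (sum_hookColoring x.1.2.2 x.2).trans (by rw [x.1.2.1])⟩
  have hF : Function.Bijective F := by
    constructor
    · rintro ⟨⟨T, hT⟩, e⟩ ⟨⟨T', hT'⟩, e'⟩ h
      have h1 : ∀ v, hookColoring T hT.2 e v = hookColoring T' hT'.2 e' v := fun v =>
        DFunLike.congr_fun (congrArg Subtype.val h) v
      have hTT : T = T' := by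
        ext v
        have hmem : ∀ (S : Finset V) (hS : G.IsIndepSet (S : Set V)) (f : {v // v ∉ S} ≃ Fin m),
            v ∈ S ↔ hookColoring S hS f v = 0 := fun S hS f =>
          ⟨hookColoring_of_mem hS f, fun h0 => by
            by_contra hv
            rw [hookColoring_of_notMem hS f hv] at h0
            omega⟩
        rw [hmem T hT.2 e, hmem T' hT'.2 e', h1]
      subst hTT
      congr 1
      ext v
      have h2 := h1 v
      rw [hookColoring_of_notMem _ _ v.2, hookColoring_of_notMem _ _ v.2] at h2
      exact Nat.succ_injective h2
    · rintro ⟨κ, hκ⟩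
      have hcard : ∀ j, (Finset.univ.filter fun v => κ v = j).card = hookContent k m j := fun j => by
        rw [← hκ]; exact (sum_single_apply κ j).symm
      set T := Finset.univ.filter fun v => κ v = 0 with hTdef
      have hmem : ∀ v, v ∈ T ↔ κ v = 0 := fun v => by simp [hTdef]
      have hTk : T.card = k := by rw [hcard, hookContent_zero]
      have hTi : G.IsIndepSet (T : Set V) := fun v hv w hw _ hvw =>
        κ.valid hvw (((hmem v).1 hv).trans ((hmem w).1 hw).symm)
      -- The content vanishes at colours above `m`. The truncated subtraction is harmless, since `κ
      -- v ≠ 0` off `T`.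
      have hlt : ∀ v : {v // v ∉ T}, κ v - 1 < m := by
        intro v
        obtain ⟨j, hj⟩ := Nat.exists_eq_succ_of_ne_zero (mt (hmem v).2 v.2)
        have h1 := hcard (j + 1)
        rw [hookContent_succ] at h1
        by_contra h2
        rw [if_neg (by omega), Finset.card_eq_zero] at h1
        exact Finset.notMem_empty (v : V) (h1 ▸ Finset.mem_filter.2 ⟨Finset.mem_univ _, hj⟩)
      -- Each positive colour has multiplicity at most `1` in the content; bijectivity then follows
      -- from equal cardinalities.
      have hinj : Function.Injective fun v : {v // v ∉ T} => (⟨κ v - 1, hlt v⟩ : Fin m) := by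
        intro v w hvw
        have h0 : κ v - 1 = κ w - 1 := congrArg Fin.val hvw
        obtain ⟨j, hj⟩ := Nat.exists_eq_succ_of_ne_zero (mt (hmem v).2 v.2)
        obtain ⟨i, hi⟩ := Nat.exists_eq_succ_of_ne_zero (mt (hmem w).2 w.2)
        have hij : i = j := by omega
        subst hij
        have h1 := hcard (i + 1)
        rw [hookContent_succ] at h1
        refine Subtype.ext (Finset.card_le_one.1 (h1.le.trans ?_) v ?_ w ?_)
        · split_ifs <;> simp
        · exact Finset.mem_filter.2 ⟨Finset.mem_univ _, hj⟩
        · exact Finset.mem_filter.2 ⟨Finset.mem_univ _, hi⟩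
      have hbij := (Fintype.bijective_iff_injective_and_card _).2 ⟨hinj, by
        rw [Fintype.card_fin, Fintype.card_subtype_compl, Fintype.card_coe, hTk, hV,
          Nat.add_sub_cancel]⟩
      refine ⟨⟨⟨T, hTk, hTi⟩, Equiv.ofBijective _ hbij⟩, Subtype.ext ?_⟩
      ext v
      change hookColoring T hTi (Equiv.ofBijective _ hbij) v = κ v
      by_cases hv : v ∈ T
      · rw [hookColoring_of_mem _ _ hv, (hmem v).1 hv]
      · rw [hookColoring_of_notMem _ _ hv, Equiv.ofBijective_apply]
        exact Nat.sub_add_cancel (Nat.pos_of_ne_zero (mt (hmem v).2 hv))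
  rw [← Nat.card_congr (Equiv.ofBijective F hF), Nat.card_sigma]
  have hcount : ∀ T : {T : Finset V // T.card = k ∧ G.IsIndepSet T},
      Nat.card ({v // v ∉ T.1} ≃ Fin m) = m.factorial := by
    rintro ⟨T, hT⟩
    have h : Fintype.card {v // v ∉ T} = m := by
      rw [Fintype.card_subtype_compl, Fintype.card_coe, hT.1, hV, Nat.add_sub_cancel]
    rw [Nat.card_eq_fintype_card, Fintype.card_equiv (Fintype.equivFinOfCardEq h), h]
  rw [Finset.sum_congr rfl fun T _ => hcount T, Finset.sum_const, smul_eq_mul, indepCount,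
    Finset.card_univ, Fintype.card_subtype]

theorem fac_hook {k : ℕ+} (hk : k ≠ 1) (m : ℕ) : fac (hook k m) = m.factorial := by
  rw [hook, fac_add_single, Finsupp.single_apply, if_neg hk.symm, fac,
    Finsupp.prod_single_index (by rfl)]
  simp

theorem fac_ones (m : ℕ) : fac (Finsupp.single 1 m) = m.factorial := by
  rw [fac, Finsupp.prod_single_index (by rfl)]

/-- The `m̃`-coordinates of the chromatic symmetric function of an unweighted graph. -/
def csfCoord (K : Type*) [Field K] [CharZero K] {V : Type*} [Fintype V] (G : SimpleGraph V) :
    MvPolynomial ℕ+ K :=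
  (mTildeEquiv K).symm (csf K G fun _ => 1)

theorem mTildeMap_csfCoord (K : Type*) [Field K] [CharZero K] {V : Type*} [Fintype V]
    (G : SimpleGraph V) : mTildeMap K (csfCoord K G) = csf K G fun _ => 1 :=
  (mTildeEquiv K).apply_symm_apply _

theorem fac_mul_coeff_csfCoord {K : Type*} [Field K] [CharZero K] {V : Type*} [Fintype V]
    (G : SimpleGraph V) (d : ℕ →₀ ℕ) :
    (fac (shape d) : K) * (csfCoord K G).coeff (shape d) =
      (Nat.card {κ : G.Coloring ℕ //
        ∑ v, Finsupp.single (κ v) (((fun _ => 1 : V → ℕ+) v : ℕ+) : ℕ) = d} : K) := by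
  rw [← coeff_mTildeMap, mTildeMap_csfCoord]
  rfl

/-- The `m!` labellings of the singleton classes cancel the factor `m!` that `m̃` carries over `m`.
For `k = 1` that factor would be `(m + 1)!` instead. -/
theorem coeff_hook_csfCoord {K : Type*} [Field K] [CharZero K] {V : Type*} [Fintype V]
    (G : SimpleGraph V) {k : ℕ+} (hk : k ≠ 1) {m : ℕ} (hV : Fintype.card V = m + k) :
    (csfCoord K G).coeff (hook k m) = indepCount G k := by
  have h := fac_mul_coeff_csfCoord (K := K) G (hookContent k m)
  rw [shape_hookContent, card_hook_colorings G hV, fac_hook hk, Nat.cast_mul, mul_comm] at h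
  exact mul_right_cancel₀ (Nat.cast_ne_zero.2 (Nat.factorial_ne_zero m)) h

theorem indepCount_one {V : Type*} [Fintype V] (G : SimpleGraph V) :
    indepCount G 1 = Fintype.card V := by
  classical
  rw [indepCount, ← Finset.card_univ, ← Nat.choose_one_right Finset.univ.card,
    ← Finset.card_powersetCard]
  congr 1
  ext T
  rw [Finset.mem_filter, Finset.mem_powersetCard_univ]
  refine ⟨fun h => h.2.1, fun h => ⟨Finset.mem_univ _, h, ?_⟩⟩
  obtain ⟨v, rfl⟩ := Finset.card_eq_one.1 h
  simp [SimpleGraph.IsIndepSet]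

/-- The only partition of the vertices into singletons is counted once: the `(m + 1) * m!`
colourings are cancelled by the factor `(m + 1)!` of `m̃`. -/
theorem coeff_ones_csfCoord {K : Type*} [Field K] [CharZero K] {V : Type*} [Fintype V]
    (G : SimpleGraph V) {m : ℕ} (hV : Fintype.card V = m + 1) :
    (csfCoord K G).coeff (Finsupp.single 1 (m + 1)) = 1 := by
  have h := fac_mul_coeff_csfCoord (K := K) G (hookContent (1 : ℕ+) m)
  have e : hook 1 m = Finsupp.single 1 (m + 1) := by rw [hook, Finsupp.single_add]
  rw [shape_hookContent, e, PNat.one_coe, card_hook_colorings G hV, fac_ones, indepCount_one, hV,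
    Nat.factorial_succ] at h
  exact mul_left_cancel₀ (Nat.cast_ne_zero.2 (Nat.factorial_succ m ▸
    Nat.factorial_ne_zero (m + 1))) (h.trans (mul_one _).symm)

theorem csfCoord_isWeightedHomogeneous {K : Type*} [Field K] [CharZero K] {V : Type*} [Fintype V]
    (G : SimpleGraph V) :
    (csfCoord K G).IsWeightedHomogeneous partSize (Fintype.card V) := by
  intro r hr
  obtain ⟨d, rfl⟩ := exists_shape r
  have h := fac_mul_coeff_csfCoord (K := K) G d
  have h0 : Nat.card {κ : G.Coloring ℕ //
      ∑ v, Finsupp.single (κ v) (((fun _ => 1 : V → ℕ+) v : ℕ+) : ℕ) = d} ≠ 0 := by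
    intro h0
    rw [h0, Nat.cast_zero] at h
    exact mul_ne_zero (Nat.cast_ne_zero.2 (fac_ne_zero _)) hr h
  obtain ⟨⟨κ, hκ⟩⟩ := (Nat.card_ne_zero.1 h0).1
  rw [weight_shape, ← hκ, map_sum]
  simp

/-! ### Triples of vertices and their excess -/

/-- A walk between distinct vertices is contracted edge by edge from its far end until one edge is
left. -/
theorem eq_top_of_adj_trans {V : Type*} {G : SimpleGraph V} (hG : G.Connected)
    (h : ∀ a b c, G.Adj a b → G.Adj b c → a ≠ c → G.Adj a c) : G = ⊤ := by
  have key : ∀ u v, G.Walk u v → u ≠ v → G.Adj u v := by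
    intro u v p
    induction p with
    | nil => exact fun h => absurd rfl h
    | @cons u v w hadj p ih =>
      intro huw
      by_cases hvw : v = w
      · exact hvw ▸ hadj
      · exact h _ _ _ hadj (ih hvw) huw
  ext u v
  rw [SimpleGraph.top_adj]
  exact ⟨fun h => h.ne, fun huv => key u v (hG.preconnected u v).some huv⟩

theorem cast_indepCount {V : Type*} [Fintype V] (G : SimpleGraph V) (k : ℕ) :
    (indepCount G k : ℤ) = open Classical in ∑ T ∈ (Finset.univ : Finset V).powersetCard k,
      if G.IsIndepSet (T : Set V) then 1 else 0 := by
  classical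
  rw [indepCount, Finset.sum_boole]
  congr 2
  ext T
  simp

/-- The number of edges that `T` spans, minus `1`, plus `1` if `T` is stable. -/
def spanExcess {V : Type*} (G : SimpleGraph V) (T : Finset V) : ℤ :=
  open Classical in (if G.IsIndepSet (T : Set V) then 1 else 0) +
    (∑ p ∈ T.powersetCard 2, (1 - if G.IsIndepSet (p : Set V) then 1 else 0)) - 1

theorem isIndepSet_pair {V : Type*} [DecidableEq V] {G : SimpleGraph V} {a b : V} :
    G.IsIndepSet (({a, b} : Finset V) : Set V) ↔ ¬G.Adj a b := by
  rw [Finset.coe_pair, SimpleGraph.isIndepSet_iff, Set.pairwise_pair]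
  constructor
  · exact fun h hab => (h hab.ne).1 hab
  · exact fun h _ => ⟨h, fun h' => h h'.symm⟩

theorem sum_powersetCard_two_triple {V : Type*} [DecidableEq V] {a b c : V} (hab : a ≠ b)
    (hac : a ≠ c) (hbc : b ≠ c) (f : Finset V → ℤ) :
    ∑ p ∈ ({a, b, c} : Finset V).powersetCard 2, f p = f {a, b} + f {a, c} + f {b, c} := by
  have h : ({a, b, c} : Finset V).powersetCard 2 = {{a, b}, {a, c}, {b, c}} := by
    rw [Finset.powersetCard_succ_insert (by simp [hab, hac]),
      show ({b, c} : Finset V).powersetCard 2 = {{b, c}} by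
        rw [← Finset.card_pair hbc, Finset.powersetCard_self], Finset.powersetCard_one,
      Finset.map_insert, Finset.map_singleton, Finset.image_insert, Finset.image_singleton]
    ext p
    simp [or_comm]
  have h1 : ({a, b} : Finset V) ≠ {a, c} := by
    intro h
    have : b ∈ ({a, c} : Finset V) := h ▸ by simp
    simp [hab.symm, hbc] at this
  have h2 : ({a, b} : Finset V) ≠ {b, c} := by
    intro h
    have : a ∈ ({b, c} : Finset V) := h ▸ by simp
    simp [hab, hac] at this
  have h3 : ({a, c} : Finset V) ≠ {b, c} := by
    intro h
    have : a ∈ ({b, c} : Finset V) := h ▸ by simp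
    simp [hab, hac] at this
  rw [h, Finset.sum_insert (by simp [h1, h2]), Finset.sum_pair h3, add_assoc]

/-- For a triple the excess is `0`, `0`, `1`, `2` according to the number of edges. -/
theorem spanExcess_triple {V : Type*} [DecidableEq V] (G : SimpleGraph V) [DecidableRel G.Adj]
    {a b c : V} (hab : a ≠ b) (hac : a ≠ c) (hbc : b ≠ c) :
    spanExcess G {a, b, c} =
      (if G.Adj a b ∧ G.Adj b c then 1 else 0) + (if G.Adj a b ∧ G.Adj a c then 1 else 0) +
      (if G.Adj a c ∧ G.Adj b c then 1 else 0) -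
      (if G.Adj a b ∧ G.Adj a c ∧ G.Adj b c then 1 else 0) := by
  classical
  have h3 : G.IsIndepSet (({a, b, c} : Finset V) : Set V) ↔
      ¬G.Adj a b ∧ ¬G.Adj a c ∧ ¬G.Adj b c := by
    simp only [SimpleGraph.isIndepSet_iff, Set.Pairwise, Finset.coe_insert, Finset.coe_singleton,
      Set.mem_insert_iff, Set.mem_singleton_iff]
    grind [G.adj_comm a b, G.adj_comm a c, G.adj_comm b c]
  rw [spanExcess, sum_powersetCard_two_triple hab hac hbc]
  simp only [isIndepSet_pair, h3]
  by_cases h1 : G.Adj a b <;> by_cases h2 : G.Adj a c <;> by_cases h4 : G.Adj b c <;>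
    simp [h1, h2, h4]

theorem isClique_triple {V : Type*} [DecidableEq V] {G : SimpleGraph V} {a b c : V} (hab : a ≠ b)
    (hac : a ≠ c) (hbc : b ≠ c) : G.IsClique (({a, b, c} : Finset V) : Set V) ↔
      G.Adj a b ∧ G.Adj a c ∧ G.Adj b c := by
  simp only [SimpleGraph.isClique_iff, Set.Pairwise, Finset.coe_insert, Finset.coe_singleton,
    Set.mem_insert_iff, Set.mem_singleton_iff]
  grind [G.adj_comm a b, G.adj_comm a c, G.adj_comm b c]

/-- Double counting: each pair lies in `m + 1` of the triples. -/
theorem sum_powersetCard_comm {V : Type*} [Fintype V] {m : ℕ} (hV : Fintype.card V = m + 3)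
    (f : Finset V → ℤ) :
    ∑ T ∈ Finset.univ.powersetCard 3, ∑ p ∈ T.powersetCard 2, f p =
      (m + 1) * ∑ p ∈ Finset.univ.powersetCard 2, f p := by
  classical
  rw [Finset.sum_comm' (t' := Finset.univ.powersetCard 2)
    (s' := fun p => (Finset.univ.powersetCard 3).filter fun T => p ⊆ T), Finset.mul_sum]
  · refine Finset.sum_congr rfl fun p hp => ?_
    rw [Finset.mem_powersetCard_univ] at hp
    rw [Finset.sum_const, Finset.card_filter_powersetCard_subset _ _ _ (Finset.subset_univ p)
      (by omega), nsmul_eq_mul, hp, Finset.card_univ, hV, Nat.choose_one_right,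
      show m + 3 - 2 = m + 1 from rfl, Nat.cast_add, Nat.cast_one]
  · intro T p
    simp only [Finset.mem_powersetCard, Finset.mem_filter, Finset.subset_univ, true_and]
    tauto

/-- The right side is the form in which the `p_{3,1^m}`-coefficient comes out of the change of
basis; regrouped by triples it becomes a sum of local terms. -/
theorem sum_spanExcess {V : Type*} [Fintype V] (G : SimpleGraph V) {m : ℕ}
    (hV : Fintype.card V = m + 3) :
    ∑ T ∈ Finset.univ.powersetCard 3, spanExcess G T =
      indepCount G 3 + (m + 1) * ((m + 3).choose 2 - indepCount G 2) - (m + 3).choose 3 := by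
  have hc : ∀ k, ((m + 3).choose k : ℤ) = ∑ T ∈ (Finset.univ : Finset V).powersetCard k, 1 := by
    intro k
    simp [hV]
  simp only [spanExcess]
  rw [Finset.sum_sub_distrib, Finset.sum_add_distrib, sum_powersetCard_comm hV,
    Finset.sum_sub_distrib, ← hc, ← hc, cast_indepCount, cast_indepCount]

/-! ### Partitions with small parts, and polynomials of weight one and two -/

theorem eq_sum_single_of_small {v : ℕ+ →₀ ℕ} (h : ∀ i : ℕ+, 4 ≤ (i : ℕ) → v i = 0) :
    v = Finsupp.single 1 (v 1) + Finsupp.single 2 (v 2) + Finsupp.single 3 (v 3) := by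
  ext i
  by_cases hi : 4 ≤ (i : ℕ)
  · have h1 : (1 : ℕ+) ≠ i := fun h => by rw [← h, PNat.one_coe] at hi; omega
    have h2 : (2 : ℕ+) ≠ i := fun h => by rw [← h, PNat.val_ofNat] at hi; omega
    have h3 : (3 : ℕ+) ≠ i := fun h => by rw [← h, PNat.val_ofNat] at hi; omega
    simp [h i hi, h1, h2, h3]
  · have hpos := i.pos
    have h4 : (i : ℕ) = 1 ∨ (i : ℕ) = 2 ∨ (i : ℕ) = 3 := by omega
    rcases h4 with h4 | h4 | h4
    · obtain rfl : i = 1 := PNat.eq h4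
      simp
    · obtain rfl : i = 2 := PNat.eq h4
      simp
    · obtain rfl : i = 3 := PNat.eq h4
      simp

theorem mul_le_weight (v : ℕ+ →₀ ℕ) (i : ℕ+) : v i * (i : ℕ) ≤ Finsupp.weight partSize v := by
  classical
  by_cases hi : i ∈ v.support
  · rw [Finsupp.weight_apply]
    exact Finset.single_le_sum (f := fun i : ℕ+ => v i • (i : ℕ)) (fun _ _ => Nat.zero_le _) hi
  · rw [Finsupp.notMem_support_iff.1 hi, zero_mul]
    exact Nat.zero_le _

/-- Size minus number of parts is the sum of `v j * (j - 1)`, of which a single term is kept. When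
this difference is `2`, it rules out parts larger than `3`. -/
theorem degree_add_mul_le_weight (v : ℕ+ →₀ ℕ) (i : ℕ+) :
    v.degree + v i * ((i : ℕ) - 1) ≤ Finsupp.weight partSize v := by
  classical
  have h : Finsupp.weight partSize v = v.degree + ∑ j ∈ v.support, v j * ((j : ℕ) - 1) := by
    rw [Finsupp.weight_apply, Finsupp.degree_apply, ← Finset.sum_add_distrib]
    refine Finset.sum_congr rfl fun j _ => ?_
    obtain ⟨k, hk⟩ := Nat.exists_eq_succ_of_ne_zero j.ne_zero
    simp only [partSize, smul_eq_mul, hk, Nat.succ_sub_one, Nat.mul_succ]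
    ring
  rw [h]
  refine Nat.add_le_add_left ?_ _
  by_cases hi : i ∈ v.support
  · exact Finset.single_le_sum (f := fun j : ℕ+ => v j * ((j : ℕ) - 1))
      (fun _ _ => Nat.zero_le _) hi
  · rw [Finsupp.notMem_support_iff.1 hi, zero_mul]
    exact Nat.zero_le _

theorem weight_sum_single (a b c : ℕ) : Finsupp.weight partSize
    (Finsupp.single 1 a + Finsupp.single 2 b + Finsupp.single 3 c) = a + b * 2 + c * 3 := by
  simp [partSize, Finsupp.weight_single]

/-- A partition of `m + 3` with `m + 1` parts is `(3, 1, …)` or `(2, 2, 1, …)`. -/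
theorem eq_of_weight_of_degree {v : ℕ+ →₀ ℕ} {m : ℕ} (hw : Finsupp.weight partSize v = m + 3)
    (hd : v.degree = m + 1) :
    v = hook 3 m ∨ ∃ l, v = Finsupp.single 1 l + Finsupp.single 2 2 := by
  have h := eq_sum_single_of_small (v := v) fun i hi => by
    have h1 := degree_add_mul_le_weight v i
    by_contra h0
    have h2 : 1 * 3 ≤ v i * ((i : ℕ) - 1) := Nat.mul_le_mul (Nat.pos_of_ne_zero h0) (by omega)
    omega
  generalize v 1 = a at h
  generalize v 2 = b at h
  generalize v 3 = c at h
  subst h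
  rw [weight_sum_single] at hw
  simp only [map_add, Finsupp.degree_single] at hd
  have h3 : c = 1 ∧ b = 0 ∧ a = m ∨ c = 0 ∧ b = 2 := by omega
  rcases h3 with ⟨rfl, rfl, rfl⟩ | ⟨rfl, rfl⟩
  · left; simp [hook]
  · right; exact ⟨a, by simp⟩

theorem eq_X_one {K : Type*} [Field K] {P : MvPolynomial ℕ+ K}
    (hP : P.IsWeightedHomogeneous partSize 1) (h1 : P.coeff (Finsupp.single 1 1) = 1) :
    P = MvPolynomial.X 1 := by
  classical
  ext v
  rw [MvPolynomial.coeff_X]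
  split_ifs with h
  · rw [← h, h1]
  · by_contra h0
    have hw := hP h0
    have hv := eq_sum_single_of_small (v := v) fun i hi => by
      have := mul_le_weight v i
      by_contra h0
      nlinarith [Nat.pos_of_ne_zero h0]
    refine h ?_
    generalize v 1 = a at hv
    generalize v 2 = b at hv
    generalize v 3 = c at hv
    subst hv
    rw [weight_sum_single] at hw
    obtain ⟨rfl, rfl, rfl⟩ : a = 1 ∧ b = 0 ∧ c = 0 := by omega
    simp

/-- The partitions of `2` are `(1,1)` and `(2)`. This serves both the `p`-expansion and the
`m̃`-expansion of a graph on two vertices. -/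
theorem eq_of_isWeightedHomogeneous_two {K : Type*} [Field K] {P : MvPolynomial ℕ+ K}
    (hP : P.IsWeightedHomogeneous partSize 2) (h1 : P.coeff (Finsupp.single 1 2) = 1) :
    P = MvPolynomial.X 1 ^ 2 + P.coeff (hook 2 0) • MvPolynomial.X 2 := by
  classical
  have h2 : hook 2 0 = Finsupp.single 2 1 := by simp [hook]
  have h12 : (Finsupp.single 1 2 : ℕ+ →₀ ℕ) ≠ Finsupp.single 2 1 := by
    intro h
    have := DFunLike.congr_fun h 1
    simp at this
  ext v
  rw [h2, MvPolynomial.coeff_add, MvPolynomial.coeff_smul, MvPolynomial.coeff_X,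
    MvPolynomial.coeff_X_pow]
  by_cases hv1 : Finsupp.single 1 2 = v
  · subst hv1
    simp [h1, h12.symm]
  · by_cases hv2 : Finsupp.single 2 1 = v
    · subst hv2
      simp [h12]
    · rw [if_neg hv1, if_neg hv2, smul_zero, add_zero]
      by_contra h0
      have hw := hP h0
      have hv := eq_sum_single_of_small (v := v) fun i hi => by
        have := mul_le_weight v i
        by_contra h0
        nlinarith [Nat.pos_of_ne_zero h0]
      generalize v 1 = a at hv
      generalize v 2 = b at hv
      generalize v 3 = c at hv
      subst hv
      rw [weight_sum_single] at hw
      have h3 : a = 2 ∧ b = 0 ∧ c = 0 ∨ a = 0 ∧ b = 1 ∧ c = 0 := by omega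
      rcases h3 with ⟨rfl, rfl, rfl⟩ | ⟨rfl, rfl, rfl⟩
      · exact hv1 (by simp)
      · exact hv2 (by simp)

/-! ### Substitutions by linear forms, at the hook with part three -/

theorem isHomogeneous_algHom_monomial {K : Type*} [Field K]
    {Φ : MvPolynomial ℕ+ K →ₐ[K] MvPolynomial ℕ+ K}
    (hΦ : ∀ n, (Φ (MvPolynomial.X n)).IsHomogeneous 1) (v : ℕ+ →₀ ℕ) :
    (Φ (MvPolynomial.monomial v 1)).IsHomogeneous v.degree := by
  have h := (MvPolynomial.isHomogeneous_monomial (R := K) (d := v) 1 rfl).aeval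
    (fun n => Φ (MvPolynomial.X n)) hΦ
  rw [one_mul] at h
  have e : MvPolynomial.aeval (fun n => Φ (MvPolynomial.X n)) = Φ :=
    (MvPolynomial.aeval_unique Φ).symm
  rwa [e] at h

/-- Linear forms preserve the number of parts, so only monomials with `m + 1` parts matter; among
those of size `m + 3` no part exceeds `3`. Hence the values of `Φ` on `X_n` for `n ≥ 4` never enter,
although `Φ` need not respect size. -/
theorem coeff_hook_three_algHom {K : Type*} [Field K]
    {Φ : MvPolynomial ℕ+ K →ₐ[K] MvPolynomial ℕ+ K} {c : K}
    (hΦ : ∀ n, (Φ (MvPolynomial.X n)).IsHomogeneous 1)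
    (h1 : Φ (MvPolynomial.X 1) = MvPolynomial.X 1)
    (h2 : Φ (MvPolynomial.X 2) = -MvPolynomial.X 2)
    (h3 : Φ (MvPolynomial.X 3) = c • MvPolynomial.X 3)
    {P : MvPolynomial ℕ+ K} {m : ℕ} (hP : P.IsWeightedHomogeneous partSize (m + 3)) :
    (Φ P).coeff (hook 3 m) = c * P.coeff (hook 3 m) := by
  classical
  have hexp : ∀ (l k : ℕ) (i : ℕ+), MvPolynomial.monomial (Finsupp.single 1 l + Finsupp.single i k)
      (1 : K) = MvPolynomial.X 1 ^ l * MvPolynomial.X i ^ k := by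
    intro l k i
    rw [MvPolynomial.X_pow_eq_monomial, MvPolynomial.X_pow_eq_monomial,
      MvPolynomial.monomial_mul, one_mul]
  have key : ∀ v : ℕ+ →₀ ℕ, Finsupp.weight partSize v = m + 3 →
      (Φ (MvPolynomial.monomial v 1)).coeff (hook 3 m) = if v = hook 3 m then c else 0 := by
    intro v hw
    by_cases hd : v.degree = m + 1
    · rcases eq_of_weight_of_degree hw hd with rfl | ⟨l, rfl⟩
      · rw [if_pos rfl]
        have e : Φ (MvPolynomial.monomial (hook 3 m) 1) =
            c • MvPolynomial.monomial (hook 3 m) 1 := by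
          rw [hook, hexp, map_mul, map_pow, map_pow, h1, h3, pow_one, mul_smul_comm, pow_one]
        rw [e, MvPolynomial.coeff_smul, MvPolynomial.coeff_monomial, if_pos rfl, smul_eq_mul,
          mul_one]
      -- The monomial `X_1^l X_2²` is fixed, as the sign of `X_2` is squared, and it is not the
      -- hook.
      · have hne : Finsupp.single 1 l + Finsupp.single 2 2 ≠ hook 3 m := by
          intro h
          have := DFunLike.congr_fun h 2
          rw [hook_apply_eq_zero (by simp) (by simp)] at this
          simp at this
        rw [if_neg hne]
        have e : Φ (MvPolynomial.monomial (Finsupp.single 1 l + Finsupp.single 2 2) 1) =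
            MvPolynomial.monomial (Finsupp.single 1 l + Finsupp.single 2 2) 1 := by
          rw [hexp, map_mul, map_pow, map_pow, h1, h2, neg_sq]
        rw [e, MvPolynomial.coeff_monomial, if_neg hne]
    -- With any other number of parts the image lives in a degree different from that of the hook.
    · have hdeg : (hook 3 m).degree = m + 1 := by
        rw [hook, map_add, Finsupp.degree_single, Finsupp.degree_single]
      rw [(isHomogeneous_algHom_monomial hΦ v).coeff_eq_zero (by rw [hdeg]; exact Ne.symm hd),
        if_neg (fun h : v = hook 3 m => hd (h ▸ hdeg))]
  have hmon : ∀ v, MvPolynomial.monomial v (P.coeff v) =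
      P.coeff v • MvPolynomial.monomial v (1 : K) := fun v => by
    rw [MvPolynomial.smul_monomial, smul_eq_mul, mul_one]
  conv_lhs => rw [P.as_sum, map_sum, MvPolynomial.coeff_sum]
  rw [Finset.sum_congr rfl fun v hv => by
    rw [hmon, map_smul, MvPolynomial.coeff_smul, key v (hP (MvPolynomial.mem_support_iff.1 hv)),
      smul_eq_mul, mul_ite, mul_zero], Finset.sum_ite_eq']
  split_ifs with h
  · rw [mul_comm]
  · rw [MvPolynomial.notMem_support_iff.1 h, mul_zero]

/-! ### Power sum coefficients of the chromatic symmetric function -/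

/-- The power sum expansion of the chromatic symmetric function of an unweighted graph. -/
def csfPoly (K : Type*) [Field K] [CharZero K] {V : Type*} [Fintype V] (G : SimpleGraph V) :
    MvPolynomial ℕ+ K :=
  (psumEquiv K).symm (csf K G fun _ => 1)

theorem trans_csfPoly (K : Type*) [Field K] [CharZero K] {V : Type*} [Fintype V]
    (G : SimpleGraph V) : trans K (csfPoly K G) = csfCoord K G := by
  apply (mTildeMap_bijective K).1
  rw [mTildeMap_trans, mTildeMap_csfCoord]
  exact (psumEquiv K).apply_symm_apply _

theorem csfPoly_isWeightedHomogeneous {K : Type*} [Field K] [CharZero K] {V : Type*} [Fintype V]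
    (G : SimpleGraph V) : (csfPoly K G).IsWeightedHomogeneous partSize (Fintype.card V) :=
  isWeightedHomogeneous_of_trans (by
    rw [trans_csfPoly]; exact csfCoord_isWeightedHomogeneous G)

theorem coeff_ones_csfPoly {K : Type*} [Field K] [CharZero K] {V : Type*} [Fintype V]
    (G : SimpleGraph V) {m : ℕ} (hV : Fintype.card V = m + 1) :
    (csfPoly K G).coeff (Finsupp.single 1 (m + 1)) = 1 := by
  rw [← coeff_ones_trans, trans_csfPoly, coeff_ones_csfCoord G hV]

/-- This is minus the number of edges, obtained by solving `coeff_hook_two_trans` for the power sum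
coefficient. -/
theorem coeff_hook_two_csfPoly {K : Type*} [Field K] [CharZero K] {V : Type*} [Fintype V]
    (G : SimpleGraph V) {m : ℕ} (hV : Fintype.card V = m + 2) :
    (csfPoly K G).coeff (hook 2 m) = indepCount G 2 - (m + 2).choose 2 := by
  have h := coeff_hook_two_trans (csfPoly K G) m
  rw [trans_csfPoly, coeff_hook_csfCoord G (by decide) hV, coeff_ones_csfPoly G hV] at h
  rw [PNat.val_ofNat] at h
  linear_combination -h

/-- In terms of signed sums over edge sets, each pair of edges at a common vertex contributes `1`
and each triangle `-1`, which triple by triple is the excess. The proof instead solves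
`coeff_hook_three_trans`, using the coefficients already found at `1^(m+3)` and `(2,1^(m+1))`. -/
theorem coeff_hook_three_csfPoly {K : Type*} [Field K] [CharZero K] {V : Type*} [Fintype V]
    (G : SimpleGraph V) {m : ℕ} (hV : Fintype.card V = m + 3) :
    (csfPoly K G).coeff (hook 3 m) =
      ((∑ T ∈ Finset.univ.powersetCard 3, spanExcess G T : ℤ) : K) := by
  have h := coeff_hook_three_trans (csfPoly K G) m
  rw [trans_csfPoly, coeff_hook_csfCoord G (by decide) hV, coeff_ones_csfPoly G hV,
    coeff_hook_two_csfPoly G hV, PNat.val_ofNat] at h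
  rw [sum_spanExcess G hV]
  push_cast
  linear_combination -h

/-! ### The morphism as a substitution, and its first values -/

/-- A bialgebra morphism into `LamTilde K`, as a substitution of polynomials. -/
def polyHom {K : Type*} [Field K] [CharZero K] (φ : Lam K →ₐc[K] LamTilde K) :
    MvPolynomial ℕ+ K →ₐ[K] MvPolynomial ℕ+ K :=
  (tildeAlgEquiv K).symm.toAlgHom.comp ((φ : Lam K →ₐ[K] LamTilde K).comp (psumEquiv K).toAlgHom)

theorem polyHom_apply {K : Type*} [Field K] [CharZero K] (φ : Lam K →ₐc[K] LamTilde K)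
    (P : MvPolynomial ℕ+ K) : polyHom φ P = (tildeAlgEquiv K).symm (φ (psumEquiv K P)) := rfl

/-- The coalgebra structure is used here: `p_n` is primitive, hence so is its image, and
`isHomogeneous_of_primitive` applies. -/
theorem polyHom_X_isHomogeneous {K : Type*} [Field K] [CharZero K] (φ : Lam K →ₐc[K] LamTilde K)
    (n : ℕ+) : (polyHom φ (MvPolynomial.X n)).IsHomogeneous 1 := by
  rw [polyHom_apply, psumEquiv_X]
  refine isHomogeneous_of_primitive ?_
  rw [← CoalgHomClass.map_comp_comul_apply, comul_psum, map_add, TensorProduct.map_tmul,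
    TensorProduct.map_tmul]
  have h1 : (φ : Lam K →ₗ[K] LamTilde K) 1 = 1 := map_one φ
  rw [h1]
  rfl

theorem polyHom_csfPoly {K : Type*} [Field K] [CharZero K] {φ : Lam K →ₐc[K] LamTilde K}
    {V W : Type*} [Fintype V] [Fintype W] {G : SimpleGraph V} {H : SimpleGraph W}
    (h : φ (csf K G fun _ => 1) = toTilde K (csf K H fun _ => 1)) :
    polyHom φ (csfPoly K G) = csfCoord K H := by
  rw [polyHom_apply, csfPoly, AlgEquiv.apply_symm_apply, h, AlgEquiv.symm_apply_eq]
  exact congrArg (toTilde K) (mTildeMap_csfCoord K H).symm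

theorem polyHom_X_three {K : Type*} [Field K] [CharZero K] {φ : Lam K →ₐc[K] LamTilde K} {c : K}
    (h : φ (psum K 3) = c • toTilde K (mTilde K (Finsupp.single 3 1))) :
    polyHom φ (MvPolynomial.X 3) = c • MvPolynomial.X 3 := by
  rw [polyHom_apply, psumEquiv_X, h, ← tildeEquiv_monomial, map_smul]
  congr 1
  exact (tildeAlgEquiv K).symm_apply_apply _

theorem polyHom_X_one {K : Type*} [Field K] [CharZero K] {φ : Lam K →ₐc[K] LamTilde K}
    {V : Type*} [Fintype V] {G : SimpleGraph V} (hV : Fintype.card V = 1)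
    (h : φ (csf K G fun _ => 1) = toTilde K (csf K Gᶜ fun _ => 1)) :
    polyHom φ (MvPolynomial.X 1) = MvPolynomial.X 1 := by
  have e1 : csfPoly K G = MvPolynomial.X 1 :=
    eq_X_one (hV ▸ csfPoly_isWeightedHomogeneous G) (coeff_ones_csfPoly (m := 0) G hV)
  have e2 : csfCoord K Gᶜ = MvPolynomial.X 1 :=
    eq_X_one (hV ▸ csfCoord_isWeightedHomogeneous Gᶜ) (coeff_ones_csfCoord (m := 0) Gᶜ hV)
  rw [← e1, polyHom_csfPoly h, e2]
  exact e1.symm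

theorem indepCount_two_eq_zero {V : Type*} [Fintype V] {G : SimpleGraph V} (hG : G = ⊤) :
    indepCount G 2 = 0 := by
  classical
  refine Finset.card_eq_zero.2 (Finset.eq_empty_of_forall_notMem fun T hmem => ?_)
  obtain ⟨-, hT, h⟩ := Finset.mem_filter.1 hmem
  obtain ⟨a, b, hab, rfl⟩ := Finset.card_eq_two.1 hT
  exact isIndepSet_pair.1 h (hG ▸ hab)

theorem indepCount_bot {V : Type*} [Fintype V] (k : ℕ) :
    indepCount (⊥ : SimpleGraph V) k = (Fintype.card V).choose k := by
  classical
  rw [indepCount, ← Finset.card_univ, ← Finset.card_powersetCard]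
  congr 1
  ext T
  simp [SimpleGraph.isIndepSet_iff, Set.Pairwise]

/-- The edge has power sum expansion `X_1² - X_2` and its complement has `m̃`-coordinates `X_1² +
X_2`. -/
theorem polyHom_X_two {K : Type*} [Field K] [CharZero K] {φ : Lam K →ₐc[K] LamTilde K}
    (hX : polyHom φ (MvPolynomial.X 1) = MvPolynomial.X 1)
    {V : Type*} [Fintype V] (hV : Fintype.card V = 2)
    (h : φ (csf K (⊤ : SimpleGraph V) fun _ => 1) =
      toTilde K (csf K (⊤ : SimpleGraph V)ᶜ fun _ => 1)) :
    polyHom φ (MvPolynomial.X 2) = -MvPolynomial.X 2 := by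
  have e1 := eq_of_isWeightedHomogeneous_two (hV ▸ csfPoly_isWeightedHomogeneous (K := K) ⊤)
    (coeff_ones_csfPoly (m := 1) (⊤ : SimpleGraph V) hV)
  have e2 := eq_of_isWeightedHomogeneous_two (hV ▸ csfCoord_isWeightedHomogeneous (K := K) ⊥)
    (coeff_ones_csfCoord (m := 1) (⊥ : SimpleGraph V) hV)
  rw [coeff_hook_two_csfPoly _ hV, indepCount_two_eq_zero rfl] at e1
  rw [coeff_hook_csfCoord (k := 2) (m := 0) _ (by decide) hV, indepCount_bot, hV] at e2
  have h1 := polyHom_csfPoly h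
  rw [compl_top, e1, e2, map_add, map_pow, map_smul, hX] at h1
  simpa [neg_eq_iff_eq_neg] using h1

/-! ### The triangle identity and its equality case -/

theorem two_mul_le_spanExcess {V : Type*} (G : SimpleGraph V) {T : Finset V} (hT : T.card = 3) :
    open Classical in (2 * if G.IsClique (T : Set V) then 1 else 0) ≤ spanExcess G T := by
  classical
  obtain ⟨a, b, c, hab, hac, hbc, rfl⟩ := Finset.card_eq_three.1 hT
  rw [spanExcess_triple G hab hac hbc, if_congr (isClique_triple hab hac hbc) rfl rfl]
  by_cases h1 : G.Adj a b <;> by_cases h2 : G.Adj a c <;> by_cases h4 : G.Adj b c <;>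
    simp [h1, h2, h4]

/-- The number of triangles. -/
def triangleCount {V : Type*} [Fintype V] (G : SimpleGraph V) : ℤ :=
  open Classical in ∑ T ∈ (Finset.univ : Finset V).powersetCard 3,
    if G.IsClique (T : Set V) then 1 else 0

/-- Both sides are the coefficient at `m̃_{3,1^m}` of the common value `φ(X_G)`: the left through
the power sum expansion of `X_G`, the right because stable triples of the complement are triangles
of `G`. -/
theorem mul_sum_spanExcess {K : Type*} [Field K] [CharZero K] {φ : Lam K →ₐc[K] LamTilde K} {c : K}
    (h1 : polyHom φ (MvPolynomial.X 1) = MvPolynomial.X 1)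
    (h2 : polyHom φ (MvPolynomial.X 2) = -MvPolynomial.X 2)
    (h3 : polyHom φ (MvPolynomial.X 3) = c • MvPolynomial.X 3)
    {V : Type*} [Fintype V] {G : SimpleGraph V} {m : ℕ} (hV : Fintype.card V = m + 3)
    (h : φ (csf K G fun _ => 1) = toTilde K (csf K Gᶜ fun _ => 1)) :
    c * ((∑ T ∈ Finset.univ.powersetCard 3, spanExcess G T : ℤ) : K) = (triangleCount G : K) := by
  rw [← coeff_hook_three_csfPoly G hV,
    ← coeff_hook_three_algHom (polyHom_X_isHomogeneous φ) h1 h2 h3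
      (hV ▸ csfPoly_isWeightedHomogeneous G), polyHom_csfPoly h,
    coeff_hook_csfCoord (k := 3) _ (by decide) hV, PNat.val_ofNat, triangleCount,
    ← Int.cast_natCast, cast_indepCount]
  refine congrArg Int.cast (Finset.sum_congr rfl fun T _ => ?_)
  congr 1
  exact propext (SimpleGraph.isIndepSet_compl G)

theorem cliqueFree_three_of_triangleCount {V : Type*} [Fintype V] {G : SimpleGraph V}
    (h : triangleCount G = 0) : G.CliqueFree 3 := by
  classical
  intro T hT
  have h1 := (Finset.sum_eq_zero_iff_of_nonneg (fun T _ => by split_ifs <;> simp)).1 h T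
    (Finset.mem_powersetCard_univ.2 hT.card_eq)
  rw [if_pos hT.isClique] at h1
  exact one_ne_zero h1

/-- Equality of the sums forces equality in `two_mul_le_spanExcess` for every triple. A triple with
exactly two edges has excess `1` and is no clique, so adjacency is transitive on distinct vertices.
-/
theorem eq_top_of_sum_spanExcess {V : Type*} [Fintype V] {G : SimpleGraph V} (hG : G.Connected)
    (h : ∑ T ∈ Finset.univ.powersetCard 3, spanExcess G T = 2 * triangleCount G) : G = ⊤ := by
  classical
  refine eq_top_of_adj_trans hG fun a b c hab hbc hac => ?_
  have hT : ({a, b, c} : Finset V).card = 3 := Finset.card_eq_three.2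
    ⟨a, b, c, hab.ne, hac, hbc.ne, rfl⟩
  rw [triangleCount, Finset.mul_sum, eq_comm, Finset.sum_eq_sum_iff_of_le fun T hT =>
    two_mul_le_spanExcess G (Finset.mem_powersetCard_univ.1 hT)] at h
  have h1 := h {a, b, c} (Finset.mem_powersetCard_univ.2 hT)
  rw [spanExcess_triple G hab.ne hac hbc.ne,
    if_congr (isClique_triple hab.ne hac hbc.ne) rfl rfl] at h1
  by_contra h2
  simp [hab, hbc, h2] at h1

/-- The only triple is the whole vertex set, and a connected graph on it is a path or a triangle. -/
theorem sum_spanExcess_of_connected_of_card_three {V : Type*} [Fintype V] {G : SimpleGraph V}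
    (hG : G.Connected) (hV : Fintype.card V = 3) :
    (∑ T ∈ Finset.univ.powersetCard 3, spanExcess G T = 1 ∧ triangleCount G = 0) ∨
      (∑ T ∈ Finset.univ.powersetCard 3, spanExcess G T = 2 ∧ triangleCount G = 1) := by
  classical
  have hu : (Finset.univ : Finset V).powersetCard 3 = {Finset.univ} := by
    rw [← hV, ← Finset.card_univ, Finset.powersetCard_self]
  rw [triangleCount, hu, Finset.sum_singleton, Finset.sum_singleton]
  by_cases htop : G = ⊤
  · obtain ⟨a, b, c, hab, hac, hbc, h⟩ := Finset.card_eq_three.1 (Finset.card_univ.trans hV)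
    right
    rw [h, spanExcess_triple G hab hac hbc, if_congr (isClique_triple hab hac hbc) rfl rfl]
    simp [htop, hab, hac, hbc]
  · have h1 := mt (eq_top_of_adj_trans hG) htop
    push Not at h1
    obtain ⟨a, b, c, hab, hbc, hac, h⟩ := h1
    have hT : ({a, b, c} : Finset V) = Finset.univ := by
      rw [← Finset.card_eq_iff_eq_univ, hV]
      exact Finset.card_eq_three.2 ⟨a, b, c, hab.ne, hac, hbc.ne, rfl⟩
    left
    rw [← hT, spanExcess_triple G hab.ne hac hbc.ne,
      if_congr (isClique_triple hab.ne hac hbc.ne) rfl rfl]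
    simp [hab, hbc, h]

theorem sum_powersetCard_three_of_card_lt {V : Type*} [Fintype V] (hV : Fintype.card V < 3) :
    (Finset.univ : Finset V).powersetCard 3 = ∅ :=
  Finset.powersetCard_eq_empty.2 (by rwa [Finset.card_univ])

end
end ChromSym


/-! ### The dichotomy -/

theorem mainTheorem9 {K : Type*} [Field K] [CharZero K]
    (φ : ChromSym.Lam K →ₐc[K] ChromSym.LamTilde K) (c : K)
    (hφ : φ (ChromSym.psum K 3) =
      c • ChromSym.toTilde K (ChromSym.mTilde K (Finsupp.single 3 1)))
    {ι : Type*} (V : ι → Type*) [∀ i, Fintype (V i)] (G : ∀ i, SimpleGraph (V i))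
    (hconn : ∀ i, (G i).Connected)
    (hcard : ∀ n : ℕ, 1 ≤ n → ∃ i, Fintype.card (V i) = n)
    (hG : ∀ i, φ (ChromSym.csf K (G i) (fun _ => 1)) =
      ChromSym.toTilde K (ChromSym.csf K (G i)ᶜ (fun _ => 1))) :
    (c = 0 ∧ ∀ i, (G i).CliqueFree 3) ∨
    (c = 1 / 2 ∧ (∀ i, G i = ⊤) ∧
      ∀ n : ℕ, 1 ≤ n → ∃ i, Nonempty (G i ≃g (⊤ : SimpleGraph (Fin n)))) := by
  have h1 : ChromSym.polyHom φ (MvPolynomial.X 1) = MvPolynomial.X 1 := by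
    obtain ⟨i, hi⟩ := hcard 1 le_rfl
    exact ChromSym.polyHom_X_one hi (hG i)
  have h2 : ChromSym.polyHom φ (MvPolynomial.X 2) = -MvPolynomial.X 2 := by
    obtain ⟨i, hi⟩ := hcard 2 (by norm_num)
    have hi' : ¬2 < Fintype.card (V i) := by omega
    -- With two vertices the transitivity condition is vacuous, as it needs three distinct vertices.
    have htop : G i = ⊤ := ChromSym.eq_top_of_adj_trans (hconn i) fun a b d hab hbd had =>
      absurd (Fintype.two_lt_card_iff.2 ⟨a, b, d, hab.ne, had, hbd.ne⟩) hi'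
    exact ChromSym.polyHom_X_two h1 hi (htop ▸ hG i)
  have h3 := ChromSym.polyHom_X_three hφ
  have key : ∀ i, c * ((∑ T ∈ Finset.univ.powersetCard 3, ChromSym.spanExcess (G i) T : ℤ) : K) =
      (ChromSym.triangleCount (G i) : K) := by
    intro i
    -- Below three vertices there are no triples and both sides are zero; otherwise `m` is the
    -- number of vertices minus `3`.
    by_cases hi : Fintype.card (V i) < 3
    · rw [ChromSym.triangleCount, ChromSym.sum_powersetCard_three_of_card_lt hi]
      simp
    · exact ChromSym.mul_sum_spanExcess h1 h2 h3
        (Nat.sub_add_cancel (not_lt.1 hi)).symm (hG i)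
  -- A single graph on three vertices decides the value of `c`, and with it the case for the whole
  -- family.
  obtain ⟨j, hj⟩ := hcard 3 (by norm_num)
  have hc := key j
  rcases ChromSym.sum_spanExcess_of_connected_of_card_three (hconn j) hj with ⟨e1, e2⟩ | ⟨e1, e2⟩
  · left
    rw [e1, e2, Int.cast_one, mul_one, Int.cast_zero] at hc
    refine ⟨hc, fun i => ChromSym.cliqueFree_three_of_triangleCount ?_⟩
    have hi := key i
    rw [hc, zero_mul] at hi
    exact_mod_cast hi.symm
  · right
    rw [e1, e2, Int.cast_one, Int.cast_ofNat] at hc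
    have hc2 : c = 1 / 2 := eq_div_of_mul_eq two_ne_zero hc
    have htop : ∀ i, G i = ⊤ := fun i => ChromSym.eq_top_of_sum_spanExcess (hconn i) (by
      -- Doubling clears the denominator, so that the identity can be brought back from `K` to the
      -- integers.
      have hi := congrArg (fun x => 2 * x) (key i)
      simp only [hc2, ← mul_assoc] at hi
      rw [mul_one_div_cancel two_ne_zero, one_mul] at hi
      exact_mod_cast hi)
    refine ⟨hc2, htop, fun n hn => ?_⟩
    obtain ⟨i, hi⟩ := hcard n hn
    rw [← Fintype.card_fin n] at hi
    exact ⟨i, ⟨htop i ▸ SimpleGraph.Iso.completeGraph (Fintype.equivOfCardEq hi)⟩⟩
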